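/- Let $r\ge 0$ and let $\Gamma=\langle s_1,\dots,s_r\rangle$ be the free group of rank $r$, with word metric given by $s_1,\dots,s_r$ and balls $B(n)$ of radius $n$ about the identity. *Definitions.* Let $\gamma$ be a measure-preserving action of $\Gamma$ on a standard probability space $(Y,\mathcal B,m)$. For a countable measurable partition $\mathcal P$ of $Y$ put $H_m(\mathcal P)=-\sum_{P\in\mathcal P}m(P)\log m(P)\in[0,\infty]$ (with $0\log 0=0$), and for finite $W\subset\Gamma$ put $\mathcal P^W=\bigvee_{w\in W}\gamma_w\mathcal P$. If $H_m(\mathcal P)<\infty$, let $$F_m(\gamma,\mathcal P)=(1-2r)H_m(\mathcal P)+\sum_{i=1}^r H_m(\mathcal P\vee\gamma_{s_i}\mathcal P),\qquad f_m(\gamma,\mathcal P)=\inf_{n>0}F_m\bigl(\gamma,\mathcal P^{B(n)}\bigr)\in[-\infty,\infty).$$ The partition $\mathcal P$ is generating for $\gamma$ if the smallest $\gamma(\Gamma)$-invariant $\sigma$-algebra containing $\mathcal P$ is $\mathcal B$ up to sets of measure zero. The $f$-invariant $f_m(\gamma)$ is defined if there is a finite-entropy generating partition for $\gamma$, and is then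 the common value of $f_m(\gamma,\mathcal P)$ over all finite-entropy generating partitions $\mathcal P$. *Theorem.* Let $\alpha$ be a measure-preserving action of $\Gamma$ on a standard probability space $(X,\mathcal B_X,\nu)$ that has a finite-entropy generating partition. Let $G$ be a compact metrizable totally disconnected group with Haar probability measure $\mu$, and let $\beta$ be an action of $\Gamma$ on $G$ by (continuous) group automorphisms. Let $\sigma:\Gamma\times X\to G$ be a cocycle, i.e. a measurable map with $$\sigma(gh,x)=\beta_g(\sigma(h,x))\cdot\sigma(g,\alpha_h x)\qquad(g,h\in\Gamma,\ x\in X),$$ and let $\alpha\times_\sigma\beta$ be the skew-product action $(\alpha\times_\sigma\beta)_g(x,y)=(\alpha_g x,\ \beta_g(y)\cdot\sigma(g,x))$ of $\Gamma$ on $(X\times G,\nu\times\mu)$. Suppose that there is a finite-index clopen normal subgroup $N\lhd G$ such that $\{gN: g\in G\}$ is a generating partition for $\beta$. Then $f_\nu(\alpha)$, $f_\mu(\beta)$ and $f_{\nu\times\mu}(\alpha\times_\sigma\beta)$ are defined, and $$f_{\nu\times\mu}(\alpha\times_\sigma\beta)=f_\nu(\alpha)+f_\mu(\beta).$$ -/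

import Mathlib

open MeasureTheory
open scoped ENNReal

noncomputable section

namespace FInvariant

/-! A countable partition of `X` is given by a labelling `P : X → ι` with `ι` countable: the cells are
the fibres `P ⁻¹' {i}`, and empty cells are harmless.  An action of `Γ` on `X` is a homomorphism
`Γ →* Equiv.Perm X`. -/

/-- Shannon entropy `-∑ ν(P) log ν(P)` of a partition; each term is nonnegative for a
probability measure, and the value `∞` is allowed. -/
def entropy {X ι : Type*} [MeasurableSpace X] (ν : Measure X) (P : X → ι) : ℝ≥0∞ :=
  ∑' i, ENNReal.ofReal (Real.negMulLog (ν.real (P ⁻¹' {i})))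

/-- The join `P ∨ Q`. -/
def join {X ι κ : Type*} (P : X → ι) (Q : X → κ) : X → ι × κ :=
  fun x => (P x, Q x)

/-- The partition `α_g P`, with cells `α_g (P ⁻¹' {i})`. -/
def translate {Γ X ι : Type*} [Group Γ] (α : Γ →* Equiv.Perm X) (g : Γ) (P : X → ι) : X → ι :=
  fun x => P ((α g).symm x)

/-- The partition `P^W = ⋁_{w ∈ W} α_w P`. -/
def joinOver {Γ X ι : Type*} [Group Γ] (α : Γ →* Equiv.Perm X) (W : Set Γ) (P : X → ι) :
    X → (W → ι) :=
  fun x w => translate α (w : Γ) P x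

/-- The ball of radius `n` about the identity for the word metric of the free group. -/
def ball (r n : ℕ) : Set (FreeGroup (Fin r)) :=
  {g | g.norm ≤ n}

/-- `F_ν(α, P) = (1 - 2r) H(P) + ∑ᵢ H(P ∨ α_{sᵢ} P)`, used for `P` of finite entropy. -/
def bigF {r : ℕ} {X ι : Type*} [MeasurableSpace X] (α : FreeGroup (Fin r) →* Equiv.Perm X)
    (ν : Measure X) (P : X → ι) : ℝ :=
  (1 - 2 * (r : ℝ)) * (entropy ν P).toReal +
    ∑ i : Fin r, (entropy ν (join P (translate α (FreeGroup.of i) P))).toReal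

/-- `f_ν(α, P) = inf_{n > 0} F_ν(α, P^{B(n)})`, possibly `-∞`. -/
def smallF {r : ℕ} {X ι : Type*} [MeasurableSpace X] (α : FreeGroup (Fin r) →* Equiv.Perm X)
    (ν : Measure X) (P : X → ι) : EReal :=
  ⨅ (n : ℕ) (_ : 0 < n), (bigF α ν (joinOver α (ball r n) P) : EReal)

/-- The smallest `α(Γ)`-invariant σ-algebra containing the cells of `P`. -/
def invariantSigma {Γ X ι : Type*} [Group Γ] (α : Γ →* Equiv.Perm X) (P : X → ι) :
    MeasurableSpace X :=
  sInf {m | (∀ g s, MeasurableSet[m] s → MeasurableSet[m] (α g '' s)) ∧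
    ∀ i, MeasurableSet[m] (P ⁻¹' {i})}

/-- `P` is a measurable partition which is generating for `α`: the smallest invariant σ-algebra
containing `P` is the whole σ-algebra up to null sets. -/
structure IsGenerating {Γ X ι : Type*} [Group Γ] [MeasurableSpace X] (α : Γ →* Equiv.Perm X)
    (ν : Measure X) (P : X → ι) : Prop where
  measurableSet_cell : ∀ i, MeasurableSet (P ⁻¹' {i})
  exists_ae_eq : ∀ s, MeasurableSet s → ∃ t, MeasurableSet[invariantSigma α P] t ∧ t =ᵐ[ν] s

/-- `P` is a finite-entropy generating (countable) partition for `α`. -/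
def IsFiniteEntropyGenerator {Γ X : Type*} [Group Γ] [MeasurableSpace X] (α : Γ →* Equiv.Perm X)
    (ν : Measure X) (P : X → ℕ) : Prop :=
  IsGenerating α ν P ∧ entropy ν P ≠ ∞

/-- The `f`-invariant of `α` is defined and equals `a`: a finite-entropy generating partition
exists, and any such partition `P` has `f_ν(α, P) = a`. -/
def HasFInvariant {r : ℕ} {X : Type*} [MeasurableSpace X] (α : FreeGroup (Fin r) →* Equiv.Perm X)
    (ν : Measure X) (a : EReal) : Prop :=
  (∃ P : X → ℕ, IsFiniteEntropyGenerator α ν P) ∧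
    ∀ P : X → ℕ, IsFiniteEntropyGenerator α ν P → smallF α ν P = a

/-- The permutation action underlying an action by group automorphisms. -/
def autAction {Γ G : Type*} [Group Γ] [Group G] (β : Γ →* MulAut G) : Γ →* Equiv.Perm G :=
  (MulAut.toPerm G).comp β

/-- `σ : Γ × X → G` is a (measurable) cocycle for `α` and `β`. -/
structure IsCocycle {Γ X G : Type*} [Group Γ] [Group G] [MeasurableSpace X] [MeasurableSpace G]
    (α : Γ →* Equiv.Perm X) (β : Γ →* MulAut G) (σ : Γ → X → G) : Prop where
  measurable : ∀ g, Measurable (σ g)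
  map_mul : ∀ g h x, σ (g * h) x = β g (σ h x) * σ g (α h x)

theorem IsCocycle.map_one {Γ X G : Type*} [Group Γ] [Group G] [MeasurableSpace X]
    [MeasurableSpace G] {α : Γ →* Equiv.Perm X} {β : Γ →* MulAut G} {σ : Γ → X → G}
    (hσ : IsCocycle α β σ) (x : X) : σ 1 x = 1 := by
  have h := hσ.map_mul 1 1 x
  simpa using h

/-- The skew-product action `(α ×_σ β)_g (x, y) = (α_g x, β_g y · σ(g, x))`. -/
def skewProduct {Γ X G : Type*} [Group Γ] [Group G] [MeasurableSpace X] [MeasurableSpace G]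
    (α : Γ →* Equiv.Perm X) (β : Γ →* MulAut G) (σ : Γ → X → G) (hσ : IsCocycle α β σ) :
    Γ →* Equiv.Perm (X × G) :=
  MonoidHom.toHomPerm
    { toFun := fun g p => (α g p.1, β g p.2 * σ g p.1)
      map_one' := by
        funext p
        simp [hσ.map_one]
        rfl
      map_mul' := by
        intro g h
        funext p
        change _ = (α g (α h p.1), β g (β h p.2 * σ h p.1) * σ g (α h p.1))
        simp [hσ.map_mul, mul_assoc] }

theorem skewProduct_apply {Γ X G : Type*} [Group Γ] [Group G] [MeasurableSpace X]
    [MeasurableSpace G] (α : Γ →* Equiv.Perm X) (β : Γ →* MulAut G) (σ : Γ → X → G)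
    (hσ : IsCocycle α β σ) (g : Γ) (x : X) (y : G) :
    skewProduct α β σ hσ g (x, y) = (α g x, β g y * σ g x) :=
  rfl

end FInvariant

end

/-!
The entropy of `P ∨ Q` exceeds that of `P` by `H(Q | P)`.  Let `S` be the translate, by a free
generator or its inverse, of a partition coarser than `P`.  Replacing `P` by `P ∨ S` raises the sum
of the `r` entropies in the definition of `F` by at most `(2r - 1) H(S | P)`, so it does not
increase `F`.  The infimum defining `f` is therefore a limit along the balls, and in
`P^{B(k)} ∨ Q^{B(n)}` the indices `k` and `n` may tend to infinity independently.  If `P` is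
generating, then `H(Q | P^{B(k)}) → 0`, which gives the independence of `f` from the generating
partition.

Let `P` generate the base and let `π : G → K` be a homomorphism to a finite group whose fibres
generate the group action.  In the skew product, the `w`-translate of the label `π(y)` is the
`w`-translate of `π` for the group action, multiplied by the cocycle value `π(σ(w⁻¹, x))`.  Given
the cocycle values on a finite set `W` this multiplication is a bijection of the labels, so the
`W`-labels of the fibre have the entropy they have for the group action, independently of the base.
The cocycle values form a finite partition of the base, so conditioning on them costs at most
`H(cocycle | P^{B(k)})`, which tends to `0`.  Letting first `k` and then `n` tend to infinity gives
the addition formula.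
-/

noncomputable section

namespace FInvariant

open Filter Function ProbabilityTheory Topology
open scoped Pointwise

section Partition

variable {X Y ι κ τ : Type*}

theorem join_preimage_singleton (P : X → ι) (Q : X → κ) (a : ι × κ) :
    join P Q ⁻¹' {a} = P ⁻¹' {a.1} ∩ Q ⁻¹' {a.2} := by
  ext x
  simp [join, Prod.ext_iff]

theorem join_comp (P : X → ι) (Q : X → κ) (φ : Y → X) :
    join P Q ∘ φ = join (P ∘ φ) (Q ∘ φ) :=
  rfl

theorem ker_join (P : X → ι) (Q : X → κ) :
    Setoid.ker (join P Q) = Setoid.ker P ⊓ Setoid.ker Q := by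
  ext x y
  simp [join, Setoid.ker_def, Setoid.inf_def]

theorem preimage_eq_preimage_image_of_ker_le {P : X → ι} {Q : X → κ}
    (h : Setoid.ker Q ≤ Setoid.ker P) (s : Set ι) : P ⁻¹' s = Q ⁻¹' (Q '' (P ⁻¹' s)) := by
  refine (Set.subset_preimage_image _ _).antisymm ?_
  rintro x ⟨y, hy, hyx⟩
  have hPyx : P y = P x := h hyx
  rwa [Set.mem_preimage, ← hPyx]

variable [MeasurableSpace X] [MeasurableSpace Y]

/-- A labelling whose cells are measurable. -/
def IsMeasurablePartition (P : X → ι) : Prop :=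
  ∀ i, MeasurableSet (P ⁻¹' {i})

namespace IsMeasurablePartition

theorem preimage [Countable ι] {P : X → ι} (hP : IsMeasurablePartition P) (s : Set ι) :
    MeasurableSet (P ⁻¹' s) := by
  rw [← Set.biUnion_preimage_singleton]
  exact MeasurableSet.biUnion s.to_countable fun i _ => hP i

theorem join {P : X → ι} {Q : X → κ} (hP : IsMeasurablePartition P)
    (hQ : IsMeasurablePartition Q) : IsMeasurablePartition (join P Q) := fun a => by
  rw [join_preimage_singleton]
  exact (hP _).inter (hQ _)

theorem comp {P : Y → ι} (hP : IsMeasurablePartition P) {φ : X → Y} (hφ : Measurable φ) :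
    IsMeasurablePartition (P ∘ φ) :=
  fun i => hφ (hP i)

theorem of_ker_le [Countable κ] {P : X → ι} {Q : X → κ} (hQ : IsMeasurablePartition Q)
    (h : Setoid.ker Q ≤ Setoid.ker P) : IsMeasurablePartition P := fun i => by
  rw [preimage_eq_preimage_image_of_ker_le h]
  exact hQ.preimage _

theorem tsum_measure [Countable ι] {P : X → ι} (hP : IsMeasurablePartition P) (ν : Measure X) :
    ∑' i, ν (P ⁻¹' {i}) = ν Set.univ :=
  (tsum_univ fun i => ν (P ⁻¹' {i})).symm.trans
    (tsum_measure_preimage_singleton Set.countable_univ fun i _ => hP i)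

theorem hasSum_measureReal_inter [Countable ι] {P : X → ι} (hP : IsMeasurablePartition P)
    (ν : Measure X) [IsFiniteMeasure ν] (s : Set X) :
    HasSum (fun i => ν.real (P ⁻¹' {i} ∩ s)) (ν.real s) := by
  have hsum : ∑' i, ν (P ⁻¹' {i} ∩ s) = ν s := by
    simpa [Measure.restrict_apply (hP _)] using hP.tsum_measure (ν.restrict s)
  have htoReal := ENNReal.hasSum_toReal (hsum.trans_ne (measure_ne_top ν s))
  rwa [← ENNReal.tsum_toReal_eq fun _ => measure_ne_top _ _, hsum] at htoReal

end IsMeasurablePartition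

end Partition

section Entropy

variable {X Y ι κ τ : Type*} [MeasurableSpace X] [MeasurableSpace Y]

theorem entropy_comp_injective (ν : Measure X) (P : X → ι) {f : ι → κ} (hf : Injective f) :
    entropy ν (f ∘ P) = entropy ν P := by
  rw [entropy, entropy, ← hf.tsum_eq]
  · simp only [Set.preimage_comp, ← Set.image_singleton, hf.preimage_image]
  · rw [support_subset_iff']
    intro k hk
    simp [Set.preimage_comp, Set.preimage_singleton_eq_empty.2 hk]

theorem entropy_mk_ker (ν : Measure X) (P : X → ι) :
    entropy ν (Quotient.mk (Setoid.ker P)) = entropy ν P :=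
  (entropy_comp_injective ν _ (Setoid.kerLift_injective P)).symm

theorem entropy_congr (ν : Measure X) {P : X → ι} {Q : X → κ}
    (h : Setoid.ker P = Setoid.ker Q) : entropy ν P = entropy ν Q := by
  rw [← entropy_mk_ker, h, entropy_mk_ker]

theorem entropy_comp_measurePreserving {ν : Measure X} {μ : Measure Y} {φ : X → Y}
    (hφ : MeasurePreserving φ ν μ) {P : Y → ι} (hP : IsMeasurablePartition P) :
    entropy ν (P ∘ φ) = entropy μ P := by
  simp only [entropy, Set.preimage_comp, hφ.measureReal_preimage (hP _).nullMeasurableSet]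

theorem tsum_negMulLog_mul_measureReal [Countable κ] (μ : Measure Y) [IsProbabilityMeasure μ]
    {Q : Y → κ} (hQ : IsMeasurablePartition Q) {x : ℝ} (hx₀ : 0 ≤ x) (hx₁ : x ≤ 1) :
    ∑' j, ENNReal.ofReal (Real.negMulLog (x * μ.real (Q ⁻¹' {j}))) =
      ENNReal.ofReal (Real.negMulLog x) + ENNReal.ofReal x * entropy μ Q := by
  have hterm (j : κ) : ENNReal.ofReal (Real.negMulLog (x * μ.real (Q ⁻¹' {j}))) =
      ENNReal.ofReal (Real.negMulLog x) * μ (Q ⁻¹' {j}) +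
        ENNReal.ofReal x * ENNReal.ofReal (Real.negMulLog (μ.real (Q ⁻¹' {j}))) := by
    have hη : 0 ≤ Real.negMulLog (μ.real (Q ⁻¹' {j})) :=
      Real.negMulLog_nonneg measureReal_nonneg measureReal_le_one
    rw [Real.negMulLog_mul, ENNReal.ofReal_add (mul_nonneg measureReal_nonneg
      (Real.negMulLog_nonneg hx₀ hx₁)) (mul_nonneg hx₀ hη), ENNReal.ofReal_mul measureReal_nonneg,
      ENNReal.ofReal_mul hx₀, ofReal_measureReal, mul_comm]
  simp_rw [hterm, ENNReal.tsum_add, ENNReal.tsum_mul_left, hQ.tsum_measure, measure_univ, mul_one,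
    entropy]

theorem entropy_prod [Countable ι] [Countable κ] (ν : Measure X) [IsProbabilityMeasure ν]
    (μ : Measure Y) [IsProbabilityMeasure μ] {P : X → ι} {Q : Y → κ}
    (hP : IsMeasurablePartition P) (hQ : IsMeasurablePartition Q) :
    entropy (ν.prod μ) (join (P ∘ Prod.fst) (Q ∘ Prod.snd)) = entropy ν P + entropy μ Q := by
  have hcell (i : ι) (j : κ) : join (P ∘ Prod.fst) (Q ∘ Prod.snd) ⁻¹' {(i, j)} =
      (P ⁻¹' {i}) ×ˢ (Q ⁻¹' {j}) :=
    join_preimage_singleton _ _ _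
  rw [entropy, ENNReal.tsum_prod']
  simp_rw [hcell, measureReal_prod_prod,
    tsum_negMulLog_mul_measureReal μ hQ measureReal_nonneg measureReal_le_one,
    ofReal_measureReal (measure_ne_top ν _), ENNReal.tsum_add, ENNReal.tsum_mul_right,
    hP.tsum_measure, measure_univ, one_mul, entropy]

/-- The conditional Shannon entropy `H(Q | P)`: the average entropy of `Q` with respect to the
conditional measures on the cells of `P`. -/
def condEntropy (ν : Measure X) (P : X → ι) (Q : X → κ) : ℝ≥0∞ :=
  ∑' i, ν (P ⁻¹' {i}) * entropy ν[|P ⁻¹' {i}] Q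

theorem measureReal_mul_cond_measureReal (ν : Measure X) [IsFiniteMeasure ν] {p : Set X}
    (hp : MeasurableSet p) (q : Set X) : ν.real p * ν[|p].real q = ν.real (p ∩ q) := by
  simp only [measureReal_def, ← cond_mul_eq_inter hp, ENNReal.toReal_mul, mul_comm]

theorem entropy_join [Countable κ] (ν : Measure X) [IsProbabilityMeasure ν] {P : X → ι}
    {Q : X → κ} (hP : IsMeasurablePartition P) (hQ : IsMeasurablePartition Q) :
    entropy ν (join P Q) = entropy ν P + condEntropy ν P Q := by
  rw [entropy, ENNReal.tsum_prod', entropy, condEntropy, ← ENNReal.tsum_add]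
  refine tsum_congr fun i => ?_
  rcases eq_or_ne (ν (P ⁻¹' {i})) 0 with h | h
  · have hinter (s : Set X) : ν.real (P ⁻¹' {i} ∩ s) = 0 := by
      simp [measureReal_def, measure_inter_null_of_null_left s h]
    simp [join_preimage_singleton, hinter, measureReal_def, h]
  · have := cond_isProbabilityMeasure h
    simp_rw [join_preimage_singleton, ← measureReal_mul_cond_measureReal ν (hP i),
      tsum_negMulLog_mul_measureReal ν[|P ⁻¹' {i}] hQ measureReal_nonneg measureReal_le_one,
      ofReal_measureReal (measure_ne_top ν _)]

theorem negMulLog_le_tangent {x t : ℝ} (hx : 0 ≤ x) (ht : 0 < t) :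
    Real.negMulLog x ≤ x * (-Real.log t - 1) + t := by
  have hkl := mul_nonneg ht.le (InformationTheory.klFun_nonneg (div_nonneg hx ht.le))
  rcases hx.eq_or_lt with rfl | hx
  · simpa using ht.le
  · rw [InformationTheory.klFun_apply, Real.log_div hx.ne' ht.ne'] at hkl
    rw [Real.negMulLog]
    field_simp at hkl
    linarith

theorem tsum_ofReal_mul_negMulLog_le {w x : ι → ℝ} {s : ℝ} (hw : ∀ i, 0 ≤ w i)
    (hx₀ : ∀ i, 0 ≤ x i) (hx₁ : ∀ i, x i ≤ 1) (hsum_w : HasSum w 1)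
    (hsum_wx : HasSum (fun i => w i * x i) s) :
    ∑' i, ENNReal.ofReal (w i * Real.negMulLog (x i)) ≤ ENNReal.ofReal (Real.negMulLog s) := by
  have hwx (i : ι) : 0 ≤ w i * x i := mul_nonneg (hw i) (hx₀ i)
  rcases (hsum_wx.nonneg hwx).eq_or_lt with rfl | hs
  · have hzero (i : ι) : w i * x i = 0 := congrFun ((hasSum_zero_iff_of_nonneg hwx).1 hsum_wx) i
    simp [Real.negMulLog, ← mul_assoc, hzero]
  · have hle (i : ι) :
        w i * Real.negMulLog (x i) ≤ w i * x i * (-Real.log s - 1) + w i * s := by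
      rw [mul_assoc, ← mul_add]
      exact mul_le_mul_of_nonneg_left (negMulLog_le_tangent (hx₀ i) hs) (hw i)
    have hsum := (hsum_wx.mul_right (-Real.log s - 1)).add (hsum_w.mul_right s)
    calc ∑' i, ENNReal.ofReal (w i * Real.negMulLog (x i))
        ≤ ∑' i, ENNReal.ofReal (w i * x i * (-Real.log s - 1) + w i * s) :=
          ENNReal.tsum_le_tsum fun i => ENNReal.ofReal_le_ofReal (hle i)
      _ = ENNReal.ofReal (s * (-Real.log s - 1) + 1 * s) := by
          rw [← ENNReal.ofReal_tsum_of_nonneg (fun i => (mul_nonneg (hw i)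
            (Real.negMulLog_nonneg (hx₀ i) (hx₁ i))).trans (hle i)) hsum.summable, hsum.tsum_eq]
      _ = ENNReal.ofReal (Real.negMulLog s) := by
          rw [Real.negMulLog]
          ring_nf

/-- The contribution of a set `q` to the conditional entropies `H(Q | P)` of the partitions `Q`
having `q` as a cell. -/
def cellCondEntropy (ν : Measure X) (P : X → ι) (q : Set X) : ℝ≥0∞ :=
  ∑' i, ENNReal.ofReal (ν.real (P ⁻¹' {i}) * Real.negMulLog (ν[|P ⁻¹' {i}].real q))

theorem condEntropy_eq_tsum_cellCondEntropy (ν : Measure X) [IsFiniteMeasure ν] (P : X → ι)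
    (Q : X → κ) : condEntropy ν P Q = ∑' j, cellCondEntropy ν P (Q ⁻¹' {j}) := by
  simp_rw [condEntropy, cellCondEntropy, entropy, ← ENNReal.tsum_mul_left,
    ENNReal.ofReal_mul measureReal_nonneg, ofReal_measureReal (measure_ne_top ν _)]
  exact ENNReal.tsum_comm

theorem cellCondEntropy_le_negMulLog [Countable ι] (ν : Measure X) [IsProbabilityMeasure ν]
    {P : X → ι} (hP : IsMeasurablePartition P) (q : Set X) :
    cellCondEntropy ν P q ≤ ENNReal.ofReal (Real.negMulLog (ν.real q)) := by
  refine tsum_ofReal_mul_negMulLog_le (fun _ => measureReal_nonneg) (fun _ => measureReal_nonneg)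
    (fun _ => measureReal_le_one) ?_ ?_
  · simpa using hP.hasSum_measureReal_inter ν Set.univ
  · simpa only [measureReal_mul_cond_measureReal ν (hP _)] using hP.hasSum_measureReal_inter ν q

theorem condEntropy_le_entropy [Countable ι] (ν : Measure X) [IsProbabilityMeasure ν]
    {P : X → ι} (hP : IsMeasurablePartition P) (Q : X → κ) : condEntropy ν P Q ≤ entropy ν Q := by
  rw [condEntropy_eq_tsum_cellCondEntropy, entropy]
  exact ENNReal.tsum_le_tsum fun j => cellCondEntropy_le_negMulLog ν hP _

theorem condEntropy_join (ν : Measure X) [IsFiniteMeasure ν] {P : X → ι} {R : X → τ}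
    (hP : IsMeasurablePartition P) (hR : IsMeasurablePartition R) (Q : X → κ) :
    condEntropy ν (join P R) Q =
      ∑' i, ν (P ⁻¹' {i}) * condEntropy ν[|P ⁻¹' {i}] R Q := by
  simp_rw [condEntropy, ENNReal.tsum_prod', join_preimage_singleton, ← ENNReal.tsum_mul_left,
    ← cond_cond_eq_cond_inter (hP _) (hR _), ← mul_assoc, mul_comm (ν _) (ν[|P ⁻¹' {_}] _),
    cond_mul_eq_inter (hP _)]

theorem condEntropy_join_le [Countable τ] (ν : Measure X) [IsFiniteMeasure ν] {P : X → ι}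
    {R : X → τ} (hP : IsMeasurablePartition P) (hR : IsMeasurablePartition R) (Q : X → κ) :
    condEntropy ν (join P R) Q ≤ condEntropy ν P Q := by
  rw [condEntropy_join ν hP hR, condEntropy]
  refine ENNReal.tsum_le_tsum fun i => ?_
  rcases eq_or_ne (ν (P ⁻¹' {i})) 0 with h | h
  · simp [h]
  · have := cond_isProbabilityMeasure h
    gcongr
    exact condEntropy_le_entropy _ hR Q

end Entropy

section FiniteEntropy

variable {X Y ι κ τ : Type*} [MeasurableSpace X] [MeasurableSpace Y]

/-- A measurable partition of finite Shannon entropy. -/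
structure FiniteEntropy (ν : Measure X) (P : X → ι) : Prop where
  isMeasurablePartition : IsMeasurablePartition P
  ne_top : entropy ν P ≠ ∞

/-- Shannon entropy as a real number, with the junk value `0` if it is infinite. -/
def entropyReal (ν : Measure X) (P : X → ι) : ℝ :=
  (entropy ν P).toReal

/-- Conditional Shannon entropy as a real number, with the junk value `0` if it is infinite. -/
def condEntropyReal (ν : Measure X) (P : X → ι) (Q : X → κ) : ℝ :=
  (condEntropy ν P Q).toReal

theorem entropyReal_congr (ν : Measure X) {P : X → ι} {Q : X → κ}
    (h : Setoid.ker P = Setoid.ker Q) : entropyReal ν P = entropyReal ν Q := by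
  rw [entropyReal, entropy_congr ν h, entropyReal]

theorem entropyReal_comp_measurePreserving {ν : Measure X} {μ : Measure Y} {φ : X → Y}
    (hφ : MeasurePreserving φ ν μ) {P : Y → ι} (hP : IsMeasurablePartition P) :
    entropyReal ν (P ∘ φ) = entropyReal μ P := by
  rw [entropyReal, entropy_comp_measurePreserving hφ hP, entropyReal]

theorem condEntropyReal_nonneg (ν : Measure X) (P : X → ι) (Q : X → κ) :
    0 ≤ condEntropyReal ν P Q :=
  ENNReal.toReal_nonneg

theorem IsMeasurablePartition.finiteEntropy [Finite ι] {P : X → ι} (hP : IsMeasurablePartition P)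
    (ν : Measure X) : FiniteEntropy ν P := by
  have := Fintype.ofFinite ι
  refine ⟨hP, ?_⟩
  rw [entropy, tsum_fintype]
  exact ENNReal.sum_ne_top.2 fun _ _ => ENNReal.ofReal_ne_top

theorem finiteEntropy_const (ν : Measure X) : FiniteEntropy ν fun _ => () :=
  IsMeasurablePartition.finiteEntropy (fun _ => MeasurableSet.const _) ν

theorem FiniteEntropy.comp_measurePreserving {ν : Measure X} {μ : Measure Y} {φ : X → Y}
    {P : Y → ι} (hP : FiniteEntropy μ P) (hφ : MeasurePreserving φ ν μ) :
    FiniteEntropy ν (P ∘ φ) where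
  isMeasurablePartition := hP.isMeasurablePartition.comp hφ.measurable
  ne_top := by
    rw [entropy_comp_measurePreserving hφ hP.isMeasurablePartition]
    exact hP.ne_top

variable {ν : Measure X} [IsProbabilityMeasure ν]
  {P : X → ι} {Q : X → κ} {R : X → τ}

theorem FiniteEntropy.condEntropy_ne_top [Countable ι] (hQ : FiniteEntropy ν Q)
    (hP : IsMeasurablePartition P) : condEntropy ν P Q ≠ ∞ :=
  ne_top_of_le_ne_top hQ.ne_top (condEntropy_le_entropy ν hP Q)

theorem FiniteEntropy.join [Countable ι] [Countable κ] (hP : FiniteEntropy ν P)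
    (hQ : FiniteEntropy ν Q) :
    FiniteEntropy ν (join P Q) where
  isMeasurablePartition := hP.isMeasurablePartition.join hQ.isMeasurablePartition
  ne_top := by
    rw [entropy_join ν hP.isMeasurablePartition hQ.isMeasurablePartition]
    exact ENNReal.add_ne_top.2 ⟨hP.ne_top, hQ.condEntropy_ne_top hP.isMeasurablePartition⟩

theorem entropyReal_join [Countable ι] [Countable κ] (hP : FiniteEntropy ν P)
    (hQ : FiniteEntropy ν Q) :
    entropyReal ν (join P Q) = entropyReal ν P + condEntropyReal ν P Q := by
  rw [entropyReal, entropy_join ν hP.isMeasurablePartition hQ.isMeasurablePartition,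
    ENNReal.toReal_add hP.ne_top (hQ.condEntropy_ne_top hP.isMeasurablePartition), entropyReal,
    condEntropyReal]

theorem FiniteEntropy.of_ker_le [Countable κ] (hQ : FiniteEntropy ν Q)
    (h : Setoid.ker Q ≤ Setoid.ker P) :
    FiniteEntropy ν P where
  isMeasurablePartition := hQ.isMeasurablePartition.of_ker_le h
  ne_top := by
    refine ne_top_of_le_ne_top hQ.ne_top ?_
    have hker : Setoid.ker Q = Setoid.ker (FInvariant.join P Q) := by
      rw [ker_join, inf_eq_right.2 h]
    rw [entropy_congr ν hker, entropy_join ν (hQ.isMeasurablePartition.of_ker_le h)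
      hQ.isMeasurablePartition]
    exact le_self_add

theorem condEntropyReal_anti [Countable ι] [Countable κ] [Countable τ]
    (hQ : FiniteEntropy ν Q) (hR : FiniteEntropy ν R)
    (h : Setoid.ker R ≤ Setoid.ker P) : condEntropyReal ν R Q ≤ condEntropyReal ν P Q := by
  have hP := hR.of_ker_le h
  have hR_eq : entropyReal ν R = entropyReal ν (join P R) :=
    entropyReal_congr ν (by rw [ker_join, inf_eq_right.2 h])
  have hRQ_eq : entropyReal ν (join R Q) = entropyReal ν (join (join P R) Q) :=
    entropyReal_congr ν (by simp only [ker_join, inf_eq_right.2 h])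
  have hle : condEntropyReal ν (join P R) Q ≤ condEntropyReal ν P Q :=
    ENNReal.toReal_mono (hQ.condEntropy_ne_top hP.isMeasurablePartition)
      (condEntropy_join_le ν hP.isMeasurablePartition hR.isMeasurablePartition Q)
  linarith [entropyReal_join hR hQ, entropyReal_join (hP.join hR) hQ]

theorem condEntropyReal_eq_zero [Countable ι] [Countable κ] (hP : FiniteEntropy ν P)
    (h : Setoid.ker P ≤ Setoid.ker Q) :
    condEntropyReal ν P Q = 0 := by
  have hker : entropyReal ν (join P Q) = entropyReal ν P :=
    entropyReal_congr ν (by rw [ker_join, inf_eq_left.2 h])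
  linarith [entropyReal_join hP (hP.of_ker_le h)]

theorem condEntropyReal_comp_measurePreserving [Countable ι] [Countable κ] {μ : Measure Y}
    [IsProbabilityMeasure μ] {P : Y → ι} {Q : Y → κ} (hP : FiniteEntropy μ P)
    (hQ : FiniteEntropy μ Q) {φ : X → Y} (hφ : MeasurePreserving φ ν μ) :
    condEntropyReal ν (P ∘ φ) (Q ∘ φ) = condEntropyReal μ P Q := by
  have hjoin := entropyReal_comp_measurePreserving hφ (hP.join hQ).isMeasurablePartition
  rw [join_comp] at hjoin
  have hfst := entropyReal_comp_measurePreserving hφ hP.isMeasurablePartition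
  linarith [entropyReal_join hP hQ,
    entropyReal_join (hP.comp_measurePreserving hφ) (hQ.comp_measurePreserving hφ)]

theorem entropyReal_prod [Countable ι] [Countable κ] {μ : Measure Y} [IsProbabilityMeasure μ]
    {P : X → ι} {Q : Y → κ} (hP : FiniteEntropy ν P) (hQ : FiniteEntropy μ Q) :
    entropyReal (ν.prod μ) (join (P ∘ Prod.fst) (Q ∘ Prod.snd)) =
      entropyReal ν P + entropyReal μ Q := by
  rw [entropyReal, entropy_prod ν μ hP.isMeasurablePartition hQ.isMeasurablePartition,
    ENNReal.toReal_add hP.ne_top hQ.ne_top, entropyReal, entropyReal]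

end FiniteEntropy

section Action

variable {Γ X ι κ : Type*} [Group Γ] (α : Γ →* Equiv.Perm X)

theorem translate_eq_comp (g : Γ) (P : X → ι) : translate α g P = P ∘ α g⁻¹ := by
  ext x
  simp [translate]

theorem translate_join (g : Γ) (P : X → ι) (Q : X → κ) :
    translate α g (join P Q) = join (translate α g P) (translate α g Q) :=
  rfl

theorem translate_translate (g h : Γ) (P : X → ι) :
    translate α g (translate α h P) = translate α (g * h) P := by
  ext x
  simp [translate_eq_comp]

theorem translate_one (P : X → ι) : translate α 1 P = P := by
  simp [translate_eq_comp]

theorem ker_translate (g : Γ) (P : X → ι) :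
    Setoid.ker (translate α g P) = (Setoid.ker P).comap (α g).symm :=
  rfl

theorem ker_translate_mono {P : X → ι} {Q : X → κ} (h : Setoid.ker P ≤ Setoid.ker Q) (g : Γ) :
    Setoid.ker (translate α g P) ≤ Setoid.ker (translate α g Q) :=
  fun _ _ hxy => h hxy

theorem ker_translate_congr {P : X → ι} {Q : X → κ} (h : Setoid.ker P = Setoid.ker Q) (g : Γ) :
    Setoid.ker (translate α g P) = Setoid.ker (translate α g Q) := by
  rw [ker_translate, h, ker_translate]

theorem ker_joinOver (W : Set Γ) (P : X → ι) :
    Setoid.ker (joinOver α W P) = ⨅ w ∈ W, Setoid.ker (translate α w P) := by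
  refine le_antisymm (le_iInf₂ fun w hw x y hxy => congrFun hxy ⟨w, hw⟩) fun x y hxy => ?_
  exact funext fun w => (iInf₂_le w.1 w.2 :
    ⨅ v ∈ W, Setoid.ker (translate α v P) ≤ Setoid.ker (translate α w P)) hxy

theorem ker_joinOver_anti {V W : Set Γ} (h : V ⊆ W) (P : X → ι) :
    Setoid.ker (joinOver α W P) ≤ Setoid.ker (joinOver α V P) := by
  simpa only [ker_joinOver] using biInf_mono h

theorem ker_translate_joinOver (g : Γ) (W : Set Γ) (P : X → ι) :
    Setoid.ker (translate α g (joinOver α W P)) = Setoid.ker (joinOver α (g • W) P) := by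
  ext x y
  simp only [Setoid.ker_def, funext_iff, Subtype.forall, joinOver, Set.mem_smul_set, smul_eq_mul,
    forall_exists_index, and_imp, forall_apply_eq_imp_iff₂, ← translate_translate]
  rfl

variable {α} [MeasurableSpace X] {ν : Measure X}

theorem IsMeasurablePartition.joinOver (hα : ∀ g, Measurable (α g)) {P : X → ι}
    (hP : IsMeasurablePartition P) {W : Set Γ} (hW : W.Countable) :
    IsMeasurablePartition (joinOver α W P) := fun a => by
  have := hW.to_subtype
  have hcell : FInvariant.joinOver α W P ⁻¹' {a} =
      ⋂ w : W, α (w : Γ)⁻¹ ⁻¹' (P ⁻¹' {a w}) := by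
    ext x
    simp [funext_iff, FInvariant.joinOver, translate_eq_comp]
  rw [hcell]
  exact MeasurableSet.iInter fun w => hα _ (hP _)

theorem FiniteEntropy.translate (hα : ∀ g, MeasurePreserving (α g) ν ν) {P : X → ι}
    (hP : FiniteEntropy ν P) (g : Γ) : FiniteEntropy ν (translate α g P) := by
  rw [translate_eq_comp]
  exact hP.comp_measurePreserving (hα _)

variable [IsProbabilityMeasure ν] (hα : ∀ g, MeasurePreserving (α g) ν ν)

include hα

theorem condEntropyReal_translate [Countable ι] [Countable κ] {P : X → ι} {Q : X → κ}
    (hP : FiniteEntropy ν P) (hQ : FiniteEntropy ν Q) (g : Γ) :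
    condEntropyReal ν (FInvariant.translate α g P) (FInvariant.translate α g Q) =
      condEntropyReal ν P Q := by
  simp only [translate_eq_comp]
  exact condEntropyReal_comp_measurePreserving hP hQ (hα _)

theorem FiniteEntropy.joinOver [Countable ι] {P : X → ι} (hP : FiniteEntropy ν P) {W : Set Γ}
    (hW : W.Finite) : FiniteEntropy ν (joinOver α W P) := by
  induction W, hW using Set.Finite.induction_on with
  | empty =>
    refine (finiteEntropy_const ν).of_ker_le ?_
    rw [ker_joinOver, iInf_emptyset]
    exact le_top
  | @insert g W _ hW ih =>
    have := hW.to_subtype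
    refine ((hP.translate hα g).join ih).of_ker_le ?_
    rw [ker_join, ker_joinOver, ker_joinOver, iInf_insert]

variable [Countable ι] [Countable κ] {R : X → ι} {Q : X → κ}

theorem entropyReal_join_translate_join (hR : FiniteEntropy ν R) (hQ : FiniteEntropy ν Q)
    (g : Γ) :
    entropyReal ν (join (join R Q) (translate α g (join R Q))) =
      entropyReal ν (join R (translate α g R)) + condEntropyReal ν (join R (translate α g R)) Q +
        condEntropyReal ν (join (join R (translate α g R)) Q) (translate α g Q) := by
  have hRg := hR.join (hR.translate hα g)
  rw [← entropyReal_join hRg hQ, ← entropyReal_join (hRg.join hQ) (hQ.translate hα g)]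
  refine entropyReal_congr ν ?_
  simp only [translate_join, ker_join, inf_assoc, inf_left_comm (Setoid.ker Q)]

theorem condEntropyReal_join_translate_le (hR : FiniteEntropy ν R) (hQ : FiniteEntropy ν Q)
    (g : Γ) :
    condEntropyReal ν (join R (translate α g R)) Q ≤ condEntropyReal ν R Q :=
  condEntropyReal_anti hQ (hR.join (hR.translate hα g)) (by simp [ker_join])

theorem condEntropyReal_translate_le (hR : FiniteEntropy ν R) (hQ : FiniteEntropy ν Q)
    (g : Γ) :
    condEntropyReal ν (join (join R (translate α g R)) Q) (translate α g Q) ≤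
      condEntropyReal ν R Q := by
  rw [← condEntropyReal_translate hα hR hQ g]
  refine condEntropyReal_anti (hQ.translate hα g) ((hR.join (hR.translate hα g)).join hQ) ?_
  rw [ker_join, ker_join]
  exact inf_le_left.trans inf_le_right

end Action

section BigF

variable {r : ℕ} {X ι κ : Type*} [MeasurableSpace X] {ν : Measure X}
  {α : FreeGroup (Fin r) →* Equiv.Perm X}

theorem bigF_eq (P : X → ι) : bigF α ν P = (1 - 2 * (r : ℝ)) * entropyReal ν P +
    ∑ i : Fin r, entropyReal ν (join P (translate α (FreeGroup.of i) P)) :=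
  rfl

theorem bigF_congr {P : X → ι} {Q : X → κ} (h : Setoid.ker P = Setoid.ker Q) :
    bigF α ν P = bigF α ν Q := by
  have hjoin (i : Fin r) : entropyReal ν (join P (translate α (FreeGroup.of i) P)) =
      entropyReal ν (join Q (translate α (FreeGroup.of i) Q)) :=
    entropyReal_congr ν (by rw [ker_join, ker_join, h, ker_translate_congr α h])
  simp_rw [bigF_eq, hjoin, entropyReal_congr ν h]

theorem smallF_congr {P : X → ι} {Q : X → κ} (h : Setoid.ker P = Setoid.ker Q) :
    smallF α ν P = smallF α ν Q := by
  have hball (n : ℕ) : bigF α ν (joinOver α (ball r n) P) = bigF α ν (joinOver α (ball r n) Q) :=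
    bigF_congr (by simp_rw [ker_joinOver, ker_translate_congr α h])
  simp_rw [smallF, hball]

theorem bigF_joinOver (W : Set (FreeGroup (Fin r))) (P : X → ι) :
    bigF α ν (joinOver α W P) = (1 - 2 * (r : ℝ)) * entropyReal ν (joinOver α W P) +
      ∑ i : Fin r, entropyReal ν (joinOver α (W ∪ FreeGroup.of i • W) P) := by
  have hjoin (i : Fin r) : entropyReal ν (join (joinOver α W P)
      (translate α (FreeGroup.of i) (joinOver α W P))) =
        entropyReal ν (joinOver α (W ∪ FreeGroup.of i • W) P) := by
    refine entropyReal_congr ν ?_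
    rw [ker_join, ker_translate_joinOver]
    simp only [ker_joinOver, iInf_union]
  simp_rw [bigF_eq, hjoin]

variable [IsProbabilityMeasure ν] (hα : ∀ g, MeasurePreserving (α g) ν ν) [Countable ι]
  [Countable κ] {R : X → ι} {Q : X → κ}

include hα

theorem bigF_join (hR : FiniteEntropy ν R) (hQ : FiniteEntropy ν Q) :
    bigF α ν (join R Q) = bigF α ν R + (1 - 2 * (r : ℝ)) * condEntropyReal ν R Q +
      ∑ i : Fin r, (condEntropyReal ν (join R (translate α (FreeGroup.of i) R)) Q +
        condEntropyReal ν (join (join R (translate α (FreeGroup.of i) R)) Q)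
          (translate α (FreeGroup.of i) Q)) := by
  simp_rw [bigF_eq, entropyReal_join_translate_join hα hR hQ, entropyReal_join hR hQ, add_assoc,
    Finset.sum_add_distrib]
  ring

theorem bigF_join_le_add (hR : FiniteEntropy ν R) (hQ : FiniteEntropy ν Q) :
    bigF α ν (join R Q) ≤ bigF α ν R + condEntropyReal ν R Q := by
  have hsum := Finset.sum_le_card_nsmul Finset.univ (fun i : Fin r => _) _ fun i _ =>
    add_le_add (condEntropyReal_join_translate_le hα hR hQ (FreeGroup.of i))
      (condEntropyReal_translate_le hα hR hQ (FreeGroup.of i))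
  rw [Finset.card_univ, Fintype.card_fin, nsmul_eq_mul] at hsum
  linarith [bigF_join hα hR hQ]

theorem bigF_le_join_add (hR : FiniteEntropy ν R) (hQ : FiniteEntropy ν Q) :
    bigF α ν R ≤ bigF α ν (join R Q) + 2 * r * condEntropyReal ν R Q := by
  have hsum : 0 ≤ ∑ i : Fin r, (condEntropyReal ν (join R (translate α (FreeGroup.of i) R)) Q +
      condEntropyReal ν (join (join R (translate α (FreeGroup.of i) R)) Q)
        (translate α (FreeGroup.of i) Q)) :=
    Finset.sum_nonneg fun i _ =>
      add_nonneg (condEntropyReal_nonneg ν _ _) (condEntropyReal_nonneg ν _ _)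
  linarith [bigF_join hα hR hQ, condEntropyReal_nonneg ν R Q]

theorem bigF_join_translate_le (hR : FiniteEntropy ν R) (h : Setoid.ker R ≤ Setoid.ker Q)
    {j : Fin r} {s : FreeGroup (Fin r)} (hs : s = FreeGroup.of j ∨ s = (FreeGroup.of j)⁻¹) :
    bigF α ν (join R (translate α s Q)) ≤ bigF α ν R := by
  have hQ := (hR.of_ker_le h).translate hα s
  set S := translate α s Q with hS
  set c := condEntropyReal ν R S with hc
  -- One of the two increments in direction `j` vanishes, which makes up for the summand
  -- `condEntropyReal ν R S` that is not weighted by `r` in `bigF_join`.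
  have hj : condEntropyReal ν (join R (translate α (FreeGroup.of j) R)) S +
      condEntropyReal ν (join (join R (translate α (FreeGroup.of j) R)) S)
        (translate α (FreeGroup.of j) S) ≤ 2 * c - c := by
    have hRj := hR.join (hR.translate hα (FreeGroup.of j))
    have hle₁ := condEntropyReal_join_translate_le hα hR hQ (FreeGroup.of j)
    have hle₂ := condEntropyReal_translate_le hα hR hQ (FreeGroup.of j)
    rcases hs with rfl | rfl
    · rw [condEntropyReal_eq_zero hRj]
      · linarith
      · rw [ker_join]
        exact inf_le_right.trans (ker_translate_mono α h _)
    · rw [condEntropyReal_eq_zero (hRj.join hQ)]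
      · linarith
      · rw [ker_join, ker_join, hS, translate_translate, mul_inv_cancel, translate_one]
        exact inf_le_left.trans (inf_le_left.trans h)
  have hsum : ∑ i : Fin r, (condEntropyReal ν (join R (translate α (FreeGroup.of i) R)) S +
      condEntropyReal ν (join (join R (translate α (FreeGroup.of i) R)) S)
        (translate α (FreeGroup.of i) S)) ≤ ∑ i : Fin r, (2 * c - if i = j then c else 0) := by
    refine Finset.sum_le_sum fun i _ => ?_
    split_ifs with hij
    · rwa [hij]
    · linarith [condEntropyReal_join_translate_le hα hR hQ (FreeGroup.of i),
        condEntropyReal_translate_le hα hR hQ (FreeGroup.of i)]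
  simp only [Finset.sum_sub_distrib, Finset.sum_const, Finset.card_univ, Fintype.card_fin,
    nsmul_eq_mul, Finset.sum_ite_eq', Finset.mem_univ, if_true] at hsum
  linarith [bigF_join hα hR hQ]

end BigF

section Ball

variable {r : ℕ}

theorem finite_ball (r n : ℕ) : (ball r n).Finite :=
  (List.finite_length_le _ n).preimage FreeGroup.toWord_injective.injOn

instance (r n : ℕ) : Finite (ball r n) :=
  (finite_ball r n).to_subtype

theorem monotone_ball (r : ℕ) : Monotone (ball r) :=
  fun _ _ h _ hg => le_trans hg h

theorem exists_eq_mul_of_mem_ball_succ {n : ℕ} {g : FreeGroup (Fin r)} (hg : g ∈ ball r (n + 1))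
    (hg' : g ∉ ball r n) : ∃ (j : Fin r) (s w : FreeGroup (Fin r)),
      (s = FreeGroup.of j ∨ s = (FreeGroup.of j)⁻¹) ∧ w ∈ ball r n ∧ g = s * w := by
  rcases hword : g.toWord with _ | ⟨⟨j, b⟩, L⟩
  · simp [ball, FreeGroup.toWord_eq_nil_iff.1 hword] at hg'
  refine ⟨j, FreeGroup.mk [(j, b)], FreeGroup.mk L, ?_, ?_, ?_⟩
  · cases b
    · exact Or.inr (by simp [FreeGroup.of, FreeGroup.inv_mk, FreeGroup.invRev])
    · exact Or.inl rfl
  · have hnorm : g.norm ≤ n + 1 := hg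
    rw [FreeGroup.norm, hword, List.length_cons] at hnorm
    exact FreeGroup.norm_mk_le.trans (by omega)
  · rw [FreeGroup.mul_mk, List.singleton_append, ← hword, FreeGroup.mk_toWord]

variable {X ι κ : Type*} [MeasurableSpace X] {ν : Measure X} [IsProbabilityMeasure ν]
  {α : FreeGroup (Fin r) →* Equiv.Perm X} (hα : ∀ g, MeasurePreserving (α g) ν ν)
  [Countable ι] [Countable κ] {P : X → ι} {Q : X → κ}

include hα

theorem bigF_join_joinOver_insert_le (hP : FiniteEntropy ν P) (hQ : FiniteEntropy ν Q)
    {W : Set (FreeGroup (Fin r))} (hW : W.Finite) {w : FreeGroup (Fin r)} (hw : w ∈ W) {j : Fin r}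
    {s : FreeGroup (Fin r)} (hs : s = FreeGroup.of j ∨ s = (FreeGroup.of j)⁻¹) :
    bigF α ν (join (joinOver α (insert (s * w) W) P) Q) ≤ bigF α ν (join (joinOver α W P) Q) := by
  have := hW.to_subtype
  have hle : Setoid.ker (join (joinOver α W P) Q) ≤ Setoid.ker (translate α w P) := by
    rw [ker_join, ker_joinOver]
    exact inf_le_left.trans (iInf₂_le w hw)
  refine (bigF_congr ?_).trans_le
    (bigF_join_translate_le hα ((hP.joinOver hα hW).join hQ) hle hs)
  rw [translate_translate]
  simp only [ker_join, ker_joinOver, iInf_insert]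
  rw [inf_assoc, inf_comm]

theorem bigF_join_joinOver_ball_union_le (hP : FiniteEntropy ν P) (hQ : FiniteEntropy ν Q)
    {n : ℕ} {T : Set (FreeGroup (Fin r))} (hT : T.Finite) (hsub : T ⊆ ball r (n + 1)) :
    bigF α ν (join (joinOver α (ball r n ∪ T) P) Q) ≤
      bigF α ν (join (joinOver α (ball r n) P) Q) := by
  induction T, hT using Set.Finite.induction_on with
  | empty => rw [Set.union_empty]
  | @insert g T _ hT ih =>
    rw [Set.insert_subset_iff] at hsub
    refine le_trans ?_ (ih hsub.2)
    rw [Set.union_insert]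
    by_cases hg : g ∈ ball r n
    · rw [Set.insert_eq_self.2 (Set.mem_union_left T hg)]
    · obtain ⟨j, s, w, hs, hw, rfl⟩ := exists_eq_mul_of_mem_ball_succ hsub.1 hg
      exact bigF_join_joinOver_insert_le hα hP hQ ((finite_ball r n).union hT) (Or.inl hw) hs

theorem antitone_bigF_join_joinOver (hP : FiniteEntropy ν P) (hQ : FiniteEntropy ν Q) :
    Antitone fun n => bigF α ν (join (joinOver α (ball r n) P) Q) := by
  refine antitone_nat_of_succ_le fun n => ?_
  have h := bigF_join_joinOver_ball_union_le hα hP hQ (finite_ball r (n + 1)) subset_rfl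
  rwa [Set.union_eq_self_of_subset_left (monotone_ball r n.le_succ)] at h

theorem antitone_bigF_joinOver (hP : FiniteEntropy ν P) :
    Antitone fun n => bigF α ν (joinOver α (ball r n) P) := by
  have hunit (n : ℕ) : bigF α ν (joinOver α (ball r n) P) =
      bigF α ν (join (joinOver α (ball r n) P) fun _ => ()) :=
    bigF_congr (by ext; simp [Setoid.ker_def, join])
  simp_rw [hunit]
  exact antitone_bigF_join_joinOver hα hP (finiteEntropy_const ν)

theorem smallF_eq_iInf (hP : FiniteEntropy ν P) :
    smallF α ν P = ⨅ n, (bigF α ν (joinOver α (ball r n) P) : EReal) := by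
  refine le_antisymm (le_iInf fun n => ?_) (le_iInf₂ fun n _ => iInf_le _ n)
  exact (iInf₂_le (n + 1) n.succ_pos).trans
    (EReal.coe_le_coe_iff.2 (antitone_bigF_joinOver hα hP n.le_succ))

theorem smallF_ne_top (hP : FiniteEntropy ν P) : smallF α ν P ≠ ⊤ := by
  rw [smallF_eq_iInf hα hP]
  exact ne_top_of_le_ne_top (EReal.coe_ne_top _) (iInf_le _ 0)

theorem smallF_join (hP : FiniteEntropy ν P) (hQ : FiniteEntropy ν Q) :
    smallF α ν (join P Q) = ⨅ (n : ℕ) (k : ℕ),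
      (bigF α ν (join (joinOver α (ball r k) P) (joinOver α (ball r n) Q)) : EReal) := by
  have hP' (n : ℕ) := hP.joinOver hα (finite_ball r n)
  have hQ' (n : ℕ) := hQ.joinOver hα (finite_ball r n)
  have hjoin (n : ℕ) : bigF α ν (joinOver α (ball r n) (join P Q)) =
      bigF α ν (join (joinOver α (ball r n) P) (joinOver α (ball r n) Q)) :=
    bigF_congr (by simp only [ker_join, ker_joinOver, translate_join, iInf_inf_eq])
  have hcomm (n k : ℕ) : bigF α ν (join (joinOver α (ball r k) P) (joinOver α (ball r n) Q)) =
      bigF α ν (join (joinOver α (ball r n) Q) (joinOver α (ball r k) P)) :=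
    bigF_congr (by rw [ker_join, ker_join, inf_comm])
  simp_rw [smallF_eq_iInf hα (hP.join hQ), hjoin]
  refine le_antisymm (le_iInf₂ fun n k => ?_)
    (le_iInf fun n => (iInf_le _ n).trans (iInf_le _ n))
  refine (iInf_le _ (max n k)).trans (EReal.coe_le_coe_iff.2 ?_)
  refine (antitone_bigF_join_joinOver hα hP (hQ' _) (le_max_right n k)).trans ?_
  dsimp only
  rw [hcomm, hcomm]
  exact antitone_bigF_join_joinOver hα hQ (hP' k) (le_max_left n k)

end Ball

section Approximation

open scoped symmDiff

theorem negMulLog_le_add_div {x ε : ℝ} (hx₀ : 0 ≤ x) (hx₁ : x ≤ 1) (hε : 0 < ε) :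
    Real.negMulLog x ≤ ε + x * (1 - x) / ε := by
  obtain ⟨u, hu₀, rfl⟩ : ∃ u, 0 ≤ u ∧ x = u * u :=
    ⟨√x, Real.sqrt_nonneg x, (Real.mul_self_sqrt hx₀).symm⟩
  have hu₁ : u ≤ 1 := by nlinarith
  have hlog : Real.negMulLog u ≤ 1 - u := by
    have := negMulLog_le_tangent hu₀ one_pos
    rw [Real.log_one] at this
    linarith
  have hsq : (u * (1 - u)) ^ 2 ≤ u * u * (1 - u * u) := by
    nlinarith [mul_nonneg (mul_nonneg (mul_nonneg hu₀ hu₀) hu₀) (sub_nonneg.2 hu₁)]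
  calc Real.negMulLog (u * u) = 2 * (u * Real.negMulLog u) := by
        rw [Real.negMulLog_mul]
        ring
    _ ≤ 2 * (u * (1 - u)) := by gcongr
    _ ≤ ε + (u * (1 - u)) ^ 2 / ε := by
        rw [← sub_le_iff_le_add', le_div_iff₀ hε]
        linarith [sq_nonneg (ε - u * (1 - u))]
    _ ≤ ε + u * u * (1 - u * u) / ε := by gcongr

variable {X ι : Type*} [MeasurableSpace X] (ν : Measure X)

theorem measureReal_mul_cond_mul_one_sub_le [IsFiniteMeasure ν] {p q t : Set X}
    (hp : MeasurableSet p) (hq : MeasurableSet q) (ht : p ⊆ t ∨ Disjoint p t) :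
    ν.real p * (ν[|p].real q * (1 - ν[|p].real q)) ≤ ν.real (p ∩ q ∆ t) := by
  have hpq := measureReal_mul_cond_measureReal ν hp q
  have hle : ν.real (p ∩ q) ≤ ν.real p := measureReal_mono Set.inter_subset_left
  have hx₀ : 0 ≤ ν[|p].real q := measureReal_nonneg
  have hx₁ : ν[|p].real q ≤ 1 := measureReal_le_one
  rcases ht with ht | ht
  · have hdiff : p ∩ q ∆ t = p \ q := by
      ext y
      have := @ht y
      simp only [Set.mem_inter_iff, Set.mem_symmDiff, Set.mem_sdiff]
      tauto
    have hadd : ν.real (p ∩ q) + ν.real (p \ q) = ν.real p := measureReal_inter_add_sdiff hq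
    rw [hdiff]
    nlinarith
  · have hinter : p ∩ q ∆ t = p ∩ q := by
      ext y
      have := fun hy : y ∈ p => Set.disjoint_left.1 ht hy
      simp only [Set.mem_inter_iff, Set.mem_symmDiff]
      tauto
    rw [hinter]
    nlinarith [mul_nonneg (measureReal_nonneg (μ := ν) (s := p ∩ q)) hx₀]

theorem cellCondEntropy_le_add_div [Countable ι] [IsProbabilityMeasure ν] {P : X → ι}
    (hP : IsMeasurablePartition P) {q : Set X} (hq : MeasurableSet q) (T : Set ι) {ε : ℝ}
    (hε : 0 < ε) :
    cellCondEntropy ν P q ≤ ENNReal.ofReal (ε + ν.real (q ∆ (P ⁻¹' T)) / ε) := by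
  have hle (i : ι) : ν.real (P ⁻¹' {i}) * Real.negMulLog (ν[|P ⁻¹' {i}].real q) ≤
      ν.real (P ⁻¹' {i} ∩ Set.univ) * ε + ν.real (P ⁻¹' {i} ∩ q ∆ (P ⁻¹' T)) / ε := by
    have ht : P ⁻¹' {i} ⊆ P ⁻¹' T ∨ Disjoint (P ⁻¹' {i}) (P ⁻¹' T) := by
      by_cases hi : i ∈ T
      · exact Or.inl (Set.preimage_mono (by simpa using hi))
      · exact Or.inr (Disjoint.preimage _ (by simpa using hi))
    calc ν.real (P ⁻¹' {i}) * Real.negMulLog (ν[|P ⁻¹' {i}].real q)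
        ≤ ν.real (P ⁻¹' {i}) *
            (ε + ν[|P ⁻¹' {i}].real q * (1 - ν[|P ⁻¹' {i}].real q) / ε) := by
          gcongr
          exact negMulLog_le_add_div measureReal_nonneg measureReal_le_one hε
      _ = ν.real (P ⁻¹' {i} ∩ Set.univ) * ε + ν.real (P ⁻¹' {i}) *
            (ν[|P ⁻¹' {i}].real q * (1 - ν[|P ⁻¹' {i}].real q)) / ε := by
          rw [Set.inter_univ]
          ring
      _ ≤ _ := by
          gcongr
          exact measureReal_mul_cond_mul_one_sub_le ν (hP i) hq ht
  have hsum := ((hP.hasSum_measureReal_inter ν Set.univ).mul_right ε).add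
    ((hP.hasSum_measureReal_inter ν (q ∆ (P ⁻¹' T))).div_const ε)
  calc cellCondEntropy ν P q ≤ ∑' i, ENNReal.ofReal (_ + _) :=
        ENNReal.tsum_le_tsum fun i => ENNReal.ofReal_le_ofReal (hle i)
    _ = _ := by
        rw [← ENNReal.ofReal_tsum_of_nonneg (fun i => by positivity) hsum.summable, hsum.tsum_eq,
          probReal_univ, one_mul]

end Approximation

section Generating

open scoped symmDiff

variable {Γ X ι κ : Type*} [Group Γ] {α : Γ →* Equiv.Perm X} {P : X → ι}

theorem translate_preimage_singleton (α : Γ →* Equiv.Perm X) (g : Γ) (P : X → ι) (i : ι) :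
    translate α g P ⁻¹' {i} = α g '' (P ⁻¹' {i}) := by
  rw [(α g).image_eq_preimage_symm]
  rfl

theorem measurableSet_invariantSigma_translate (α : Γ →* Equiv.Perm X) (P : X → ι) (g : Γ)
    (i : ι) : MeasurableSet[invariantSigma α P] (translate α g P ⁻¹' {i}) := by
  rw [translate_preimage_singleton]
  exact MeasurableSpace.measurableSet_sInf.2 fun m hm => hm.1 g _ (hm.2 i)

theorem invariantSigma_le {m : MeasurableSpace X}
    (h : ∀ g i, MeasurableSet[m] (translate α g P ⁻¹' {i})) : invariantSigma α P ≤ m := by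
  let C : Set (Set X) := {s | ∃ g i, s = translate α g P ⁻¹' {i}}
  have hC : MeasurableSpace.generateFrom C ≤ m := by
    refine MeasurableSpace.generateFrom_le ?_
    rintro _ ⟨g, i, rfl⟩
    exact h g i
  refine le_trans (sInf_le ⟨fun g s hs => ?_, fun i => ?_⟩) hC
  · have hsymm : @Measurable _ _ (.generateFrom C) (.generateFrom C) (α g).symm := by
      refine @measurable_generateFrom _ _ (.generateFrom C) _ _ ?_
      rintro _ ⟨k, i, rfl⟩
      refine MeasurableSpace.measurableSet_generateFrom ⟨g * k, i, ?_⟩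
      rw [← translate_translate]
      rfl
    rw [(α g).image_eq_preimage_symm]
    exact hsymm hs
  · exact MeasurableSpace.measurableSet_generateFrom ⟨1, i, by rw [translate_one]⟩

/-- The sets determined by the labels of finitely many translates of `P`. -/
def cylinders (α : Γ →* Equiv.Perm X) (P : X → ι) : Set (Set X) :=
  {t | ∃ W : Finset Γ, ∃ T, t = joinOver α W P ⁻¹' T}

theorem isSetAlgebra_cylinders (α : Γ →* Equiv.Perm X) (P : X → ι) :
    IsSetAlgebra (cylinders α P) := by
  classical
  refine ⟨⟨∅, ∅, rfl⟩, ?_, ?_⟩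
  · rintro _ ⟨W, T, rfl⟩
    exact ⟨W, Tᶜ, rfl⟩
  · rintro _ _ ⟨V, T, rfl⟩ ⟨W, U, rfl⟩
    have hV := ker_joinOver_anti α (Finset.coe_subset.2 (V.subset_union_left (s₂ := W))) P
    have hW := ker_joinOver_anti α (Finset.coe_subset.2 (W.subset_union_right (s₁ := V))) P
    rw [preimage_eq_preimage_image_of_ker_le hV, preimage_eq_preimage_image_of_ker_le hW,
      ← Set.preimage_union]
    exact ⟨V ∪ W, _, rfl⟩

theorem invariantSigma_le_generateFrom_cylinders (α : Γ →* Equiv.Perm X) (P : X → ι) :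
    invariantSigma α P ≤ MeasurableSpace.generateFrom (cylinders α P) :=
  invariantSigma_le fun g i => MeasurableSpace.measurableSet_generateFrom
    ⟨{g}, {a | a ⟨g, by simp⟩ = i}, rfl⟩

variable [MeasurableSpace X] {ν : Measure X}

theorem generateFrom_cylinders_le [Countable ι] (hα : ∀ g, Measurable (α g))
    (hP : IsMeasurablePartition P) :
    MeasurableSpace.generateFrom (cylinders α P) ≤ ‹MeasurableSpace X› := by
  refine MeasurableSpace.generateFrom_le ?_
  rintro _ ⟨W, T, rfl⟩
  exact (hP.joinOver hα W.countable_toSet).preimage T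

theorem IsGenerating.isMeasurablePartition (hP : IsGenerating α ν P) : IsMeasurablePartition P :=
  hP.measurableSet_cell

theorem IsGenerating.comp_injective [Countable ι] (hP : IsGenerating α ν P) {f : ι → κ}
    (hf : Injective f) : IsGenerating α ν (f ∘ P) := by
  refine ⟨fun i => hP.isMeasurablePartition.preimage (f ⁻¹' {i}), fun s hs => ?_⟩
  obtain ⟨t, ht, hts⟩ := hP.exists_ae_eq s hs
  refine ⟨t, invariantSigma_le (fun g i => ?_) t ht, hts⟩
  have hcell : translate α g P ⁻¹' {i} = translate α g (f ∘ P) ⁻¹' {f i} := by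
    ext x
    simp [translate, hf.eq_iff]
  rw [hcell]
  exact measurableSet_invariantSigma_translate α (f ∘ P) g (f i)

theorem IsGenerating.exists_mem_cylinders_symmDiff_lt [Countable ι] [IsFiniteMeasure ν]
    (hα : ∀ g, Measurable (α g)) (hP : IsGenerating α ν P) {s : Set X} (hs : MeasurableSet s)
    {ε : ℝ} (hε : 0 < ε) : ∃ t ∈ cylinders α P, ν.real (s ∆ t) < ε := by
  have hm := generateFrom_cylinders_le hα hP.isMeasurablePartition
  obtain ⟨s', hs', hss'⟩ := hP.exists_ae_eq s hs
  replace hs' := invariantSigma_le_generateFrom_cylinders α P s' hs'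
  have hdense := @Measure.MeasureDense.of_generateFrom_isSetAlgebra_finite X
    (.generateFrom (cylinders α P)) (ν.trim hm) _ _ (isSetAlgebra_cylinders α P) rfl
  obtain ⟨t, ht, hlt⟩ := @Measure.MeasureDense.approx _ (.generateFrom (cylinders α P)) _ _ hdense
    s' hs' (@measure_ne_top _ (.generateFrom (cylinders α P)) _ _ _) ε hε
  refine ⟨t, ht, ?_⟩
  rw [trim_measurableSet_eq hm (@MeasurableSet.symmDiff _ (.generateFrom _) _ _ hs'
    (MeasurableSpace.measurableSet_generateFrom ht)),
    measure_congr (hss'.symmDiff (ae_eq_refl t))] at hlt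
  rwa [measureReal_def, ← ENNReal.lt_ofReal_iff_toReal_lt (measure_ne_top _ _)]

variable [IsProbabilityMeasure ν] [Countable ι] (hα : ∀ g, MeasurePreserving (α g) ν ν)

include hα

theorem IsGenerating.tendsto_cellCondEntropy_joinOver (hP : IsGenerating α ν P) {q : Set X}
    (hq : MeasurableSet q) :
    Tendsto (fun W : Finset Γ => cellCondEntropy ν (joinOver α W P) q) atTop (𝓝 0) := by
  refine ENNReal.tendsto_nhds_zero.2 fun ε hε => ?_
  obtain ⟨δ, hδ, hδε⟩ := ENNReal.lt_iff_exists_nnreal_btwn.1 hε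
  rw [ENNReal.coe_pos, ← NNReal.coe_pos] at hδ
  obtain ⟨_, ⟨V, T, rfl⟩, hlt⟩ := hP.exists_mem_cylinders_symmDiff_lt
    (fun g => (hα g).measurable) hq (ε := (δ / 2) ^ 2) (by positivity)
  filter_upwards [eventually_ge_atTop V] with W hW
  obtain ⟨U, hU⟩ : ∃ U, joinOver α V P ⁻¹' T = joinOver α W P ⁻¹' U :=
    ⟨_, preimage_eq_preimage_image_of_ker_le (ker_joinOver_anti α (Finset.coe_subset.2 hW) P) T⟩
  rw [hU] at hlt
  have hW' := hP.isMeasurablePartition.joinOver (fun g => (hα g).measurable) W.countable_toSet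
  refine (cellCondEntropy_le_add_div ν hW' hq U (half_pos hδ)).trans (le_trans ?_ hδε.le)
  rw [← ENNReal.ofReal_coe_nnreal]
  refine ENNReal.ofReal_le_ofReal ?_
  have hdiv := (div_le_iff₀ (half_pos hδ)).2 (hlt.le.trans_eq (sq _))
  linarith

theorem IsGenerating.tendsto_condEntropyReal_joinOver (hP : IsGenerating α ν P) {Q : X → κ}
    (hQ : FiniteEntropy ν Q) :
    Tendsto (fun W : Finset Γ => condEntropyReal ν (joinOver α W P) Q) atTop (𝓝 0) := by
  have hle (W : Finset Γ) (j : κ) : cellCondEntropy ν (joinOver α W P) (Q ⁻¹' {j}) ≤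
      ENNReal.ofReal (Real.negMulLog (ν.real (Q ⁻¹' {j}))) :=
    cellCondEntropy_le_negMulLog ν
      (hP.isMeasurablePartition.joinOver (fun g => (hα g).measurable) W.countable_toSet) _
  have hcond (W : Finset Γ) : condEntropyReal ν (joinOver α W P) Q =
      ∑' j, (cellCondEntropy ν (joinOver α W P) (Q ⁻¹' {j})).toReal := by
    rw [condEntropyReal, condEntropy_eq_tsum_cellCondEntropy, ENNReal.tsum_toReal_eq]
    exact fun j => ne_top_of_le_ne_top ENNReal.ofReal_ne_top (hle W j)
  simp_rw [hcond]
  rw [← tsum_zero (α := ℝ) (β := κ)]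
  refine tendsto_tsum_of_dominated_convergence (ENNReal.summable_toReal hQ.ne_top) (fun j => ?_)
    (.of_forall fun W j => ?_)
  · exact (ENNReal.tendsto_toReal ENNReal.zero_ne_top).comp
      (hP.tendsto_cellCondEntropy_joinOver hα (hQ.isMeasurablePartition j))
  · rw [Real.norm_of_nonneg ENNReal.toReal_nonneg]
    exact ENNReal.toReal_mono ENNReal.ofReal_ne_top (hle W j)

end Generating

section Independence

theorem iInf_const_add {τ : Type*} [Nonempty τ] {a : EReal} (ha : a ≠ ⊤) (b : τ → EReal) :
    ⨅ i, (a + b i) = a + ⨅ i, b i := by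
  rcases eq_or_ne (⨅ i, b i) ⊤ with hb | hb
  · simp [iInf_eq_top.1 hb]
  · have hadd : ContinuousAt (fun y => a + y) (⨅ i, b i) :=
      (EReal.continuousAt_add (p := (a, ⨅ i, b i)) (Or.inl ha) (Or.inr hb)).comp
        (f := fun y => (a, y)) (by fun_prop)
    exact ((add_right_mono (a := a)).map_ciInf_of_continuousAt hadd).symm

theorem iInf_coe_eq_add_of_tendsto_sub {a b : ℕ → ℝ} (ha : Antitone a) (hb : Antitone b) {c : ℝ}
    (hc : Tendsto (fun n => a n - b n) atTop (𝓝 c)) :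
    ⨅ n, (a n : EReal) = (⨅ n, (b n : EReal)) + c := by
  have ha' := tendsto_atTop_iInf (EReal.coe_strictMono.monotone.comp_antitone ha)
  have hb' := tendsto_atTop_iInf (EReal.coe_strictMono.monotone.comp_antitone hb)
  have hc' := (continuous_coe_real_ereal.tendsto c).comp hc
  have hadd := (EReal.continuousAt_add (p := (⨅ n, (b n : EReal), (c : EReal)))
    (Or.inr (EReal.coe_ne_bot c)) (Or.inr (EReal.coe_ne_top c))).tendsto.comp (hb'.prodMk_nhds hc')
  refine tendsto_nhds_unique ha' (hadd.congr fun n => ?_)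
  simp only [comp_apply, ← EReal.coe_add, add_sub_cancel]

variable {r : ℕ} {X ι κ : Type*} [MeasurableSpace X] {ν : Measure X} [IsProbabilityMeasure ν]
  {α : FreeGroup (Fin r) →* Equiv.Perm X} (hα : ∀ g, MeasurePreserving (α g) ν ν)
  [Countable ι] {P : X → ι} {Q : X → κ}

include hα

theorem IsGenerating.tendsto_condEntropyReal_joinOver_ball (hP : IsGenerating α ν P)
    (hQ : FiniteEntropy ν Q) :
    Tendsto (fun n => condEntropyReal ν (joinOver α (ball r n) P) Q) atTop (𝓝 0) := by
  have hball : Tendsto (fun n => (finite_ball r n).toFinset) atTop atTop :=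
    Monotone.tendsto_atTop_finset (fun _ _ h => by simpa using monotone_ball r h)
      fun g => ⟨g.norm, by simp [ball]⟩
  refine ((hP.tendsto_condEntropyReal_joinOver hα hQ).comp hball).congr fun n => ?_
  rw [comp_apply, Set.Finite.coe_toFinset]

variable [Countable κ]

theorem IsGenerating.iInf_bigF_join_joinOver (hg : IsGenerating α ν P) (hP : FiniteEntropy ν P)
    (hQ : FiniteEntropy ν Q) :
    ⨅ n, (bigF α ν (join (joinOver α (ball r n) P) Q) : EReal) = smallF α ν P := by
  have hR (n : ℕ) := hP.joinOver hα (finite_ball r n)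
  have hlim := hg.tendsto_condEntropyReal_joinOver_ball hα hQ
  have hlim_neg : Tendsto (fun n => -(2 * r * condEntropyReal ν (joinOver α (ball r n) P) Q))
      atTop (𝓝 0) := by
    simpa using (hlim.const_mul (2 * (r : ℝ))).neg
  have hsub : Tendsto (fun n => bigF α ν (join (joinOver α (ball r n) P) Q) -
      bigF α ν (joinOver α (ball r n) P)) atTop (𝓝 0) :=
    tendsto_of_tendsto_of_tendsto_of_le_of_le hlim_neg hlim
      (fun n => by linarith [bigF_le_join_add hα (hR n) hQ])
      (fun n => by linarith [bigF_join_le_add hα (hR n) hQ])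
  rw [smallF_eq_iInf hα hP, iInf_coe_eq_add_of_tendsto_sub
    (antitone_bigF_join_joinOver hα hP hQ) (antitone_bigF_joinOver hα hP) hsub,
    EReal.coe_zero, add_zero]

theorem IsGenerating.smallF_join (hg : IsGenerating α ν P) (hP : FiniteEntropy ν P)
    (hQ : FiniteEntropy ν Q) : smallF α ν (join P Q) = smallF α ν P := by
  have hQ' (n : ℕ) := hQ.joinOver hα (finite_ball r n)
  simp_rw [FInvariant.smallF_join hα hP hQ, hg.iInf_bigF_join_joinOver hα hP (hQ' _), iInf_const]

theorem IsGenerating.smallF_eq (hgP : IsGenerating α ν P) (hP : FiniteEntropy ν P)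
    (hgQ : IsGenerating α ν Q) (hQ : FiniteEntropy ν Q) : smallF α ν P = smallF α ν Q := by
  have hcomm : smallF α ν (join P Q) = smallF α ν (join Q P) :=
    smallF_congr (by rw [ker_join, ker_join, inf_comm])
  rw [← hgP.smallF_join hα hP hQ, hcomm, hgQ.smallF_join hα hQ hP]

theorem IsGenerating.hasFInvariant (hg : IsGenerating α ν P) (hP : entropy ν P ≠ ∞) :
    HasFInvariant α ν (smallF α ν P) := by
  obtain ⟨f, hf⟩ := exists_injective_nat ι
  refine ⟨⟨f ∘ P, hg.comp_injective hf, ?_⟩, fun Q hQ => ?_⟩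
  · rwa [entropy_comp_injective ν P hf]
  · exact hQ.1.smallF_eq hα ⟨hQ.1.measurableSet_cell, hQ.2⟩ hg ⟨hg.measurableSet_cell, hP⟩

end Independence

section Twist

variable {X Y ι K : Type*} [Group K]

theorem ker_join_twist (A : X → ι) (c : X → K) (T : Y → K) :
    Setoid.ker (join (join A c ∘ Prod.fst) fun p : X × Y => T p.2 * c p.1) =
      Setoid.ker (join (join A c ∘ Prod.fst) (T ∘ Prod.snd)) := by
  ext p p'
  simp only [Setoid.ker_def, join, comp_apply, Prod.mk.injEq]
  refine and_congr_right fun h => ?_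
  rw [h.2, mul_left_inj]

variable [MeasurableSpace X] [MeasurableSpace Y] {ν : Measure X} [IsProbabilityMeasure ν]
  {μ : Measure Y} [IsProbabilityMeasure μ] [Countable ι] [Countable K]
  {A : X → ι} {c : X → K} {T : Y → K}

theorem FiniteEntropy.join_twist (hA : FiniteEntropy ν A) (hc : FiniteEntropy ν c)
    (hT : FiniteEntropy μ T) :
    FiniteEntropy (ν.prod μ) (FInvariant.join (A ∘ Prod.fst) fun p => T p.2 * c p.1) := by
  refine (((hA.join hc).comp_measurePreserving measurePreserving_fst).join
    (hT.comp_measurePreserving measurePreserving_snd)).of_ker_le ?_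
  rw [← ker_join_twist]
  simp only [join_comp, ker_join]
  exact inf_le_inf_right _ inf_le_left

theorem entropyReal_join_twist_add (hA : FiniteEntropy ν A) (hc : FiniteEntropy ν c)
    (hT : FiniteEntropy μ T) :
    entropyReal (ν.prod μ) (join (A ∘ Prod.fst) fun p => T p.2 * c p.1) +
        condEntropyReal (ν.prod μ) (join (A ∘ Prod.fst) fun p => T p.2 * c p.1) (c ∘ Prod.fst) =
      entropyReal ν A + entropyReal μ T + condEntropyReal ν A c := by
  have hc' := hc.comp_measurePreserving (measurePreserving_fst (μ := ν) (ν := μ))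
  have hperm : entropyReal (ν.prod μ)
      (join (join (A ∘ Prod.fst) fun p => T p.2 * c p.1) (c ∘ Prod.fst)) =
      entropyReal (ν.prod μ) (join (join A c ∘ Prod.fst) fun p => T p.2 * c p.1) :=
    entropyReal_congr _ (by simp only [join_comp, ker_join, inf_right_comm])
  rw [← entropyReal_join (hA.join_twist hc hT) hc', hperm,
    entropyReal_congr _ (ker_join_twist A c T), entropyReal_prod (hA.join hc) hT,
    entropyReal_join hA hc]
  ring

theorem le_entropyReal_join_twist (hA : FiniteEntropy ν A) (hc : FiniteEntropy ν c)
    (hT : FiniteEntropy μ T) : entropyReal ν A + entropyReal μ T ≤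
      entropyReal (ν.prod μ) (join (A ∘ Prod.fst) fun p => T p.2 * c p.1) := by
  have hfst : MeasurePreserving Prod.fst (ν.prod μ) ν := measurePreserving_fst
  have hle : condEntropyReal (ν.prod μ) (join (A ∘ Prod.fst) fun p => T p.2 * c p.1)
      (c ∘ Prod.fst) ≤ condEntropyReal ν A c := by
    rw [← condEntropyReal_comp_measurePreserving hA hc hfst]
    exact condEntropyReal_anti (hc.comp_measurePreserving hfst) (hA.join_twist hc hT)
      (by simp only [ker_join, inf_le_left])
  linarith [entropyReal_join_twist_add hA hc hT]

theorem entropyReal_join_twist_le (hA : FiniteEntropy ν A) (hc : FiniteEntropy ν c)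
    (hT : FiniteEntropy μ T) :
    entropyReal (ν.prod μ) (join (A ∘ Prod.fst) fun p => T p.2 * c p.1) ≤
      entropyReal ν A + entropyReal μ T + condEntropyReal ν A c := by
  rw [← entropyReal_join_twist_add hA hc hT]
  exact le_add_of_nonneg_right (condEntropyReal_nonneg _ _ _)

end Twist

section SkewProduct

variable {Γ X G K ι : Type*} [Group Γ] [Group G] [Group K] [MeasurableSpace X]
  [MeasurableSpace G] {α : Γ →* Equiv.Perm X} {β : Γ →* MulAut G} {σ : Γ → X → G}
  (hσ : IsCocycle α β σ) (π : G →* K)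

theorem translate_skewProduct_fst (g : Γ) (P : X → ι) :
    translate (skewProduct α β σ hσ) g (P ∘ Prod.fst) = translate α g P ∘ Prod.fst := by
  simp only [translate_eq_comp]
  rfl

theorem joinOver_skewProduct_fst (W : Set Γ) (P : X → ι) :
    joinOver (skewProduct α β σ hσ) W (P ∘ Prod.fst) = joinOver α W P ∘ Prod.fst := by
  ext p w
  exact congrFun (translate_skewProduct_fst hσ w P) p

theorem translate_skewProduct_snd (g : Γ) :
    translate (skewProduct α β σ hσ) g (π ∘ Prod.snd) =
      fun p => translate (autAction β) g π p.2 * π (σ g⁻¹ p.1) := by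
  simp only [translate_eq_comp]
  ext p
  exact map_mul π _ _

/-- The partition of the base by the images in `K` of the values of the cocycle at the inverses of
the elements of `W`.  Inverses appear because `translate` and `joinOver` pull back along inverses:
these are the factors by which the skew product shifts the `W`-labels of the fibre. -/
def cocyclePartition (σ : Γ → X → G) (π : G →* K) (W : Set Γ) : X → W → K :=
  fun x w => π (σ (w : Γ)⁻¹ x)

theorem joinOver_skewProduct_snd (W : Set Γ) :
    joinOver (skewProduct α β σ hσ) W (π ∘ Prod.snd) =
      fun p => joinOver (autAction β) W π p.2 * cocyclePartition σ π W p.1 := by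
  ext p w
  exact congrFun (translate_skewProduct_snd hσ π w) p

theorem finiteEntropy_cocyclePartition [Finite K] (hσ : IsCocycle α β σ) {π : G →* K}
    (hπ : IsMeasurablePartition π) {W : Set Γ} (hW : W.Finite) (ν : Measure X) :
    FiniteEntropy ν (cocyclePartition σ π W) := by
  have := hW.to_subtype
  refine IsMeasurablePartition.finiteEntropy (fun c => ?_) ν
  have hcell : cocyclePartition σ π W ⁻¹' {c} =
      ⋂ w : W, σ (w : Γ)⁻¹ ⁻¹' (π ⁻¹' {c w}) := by
    ext x
    simp [funext_iff, cocyclePartition]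
  rw [hcell]
  exact MeasurableSet.iInter fun w => hσ.measurable _ (hπ _)

theorem measurePreserving_skewProduct [MeasurableMul₂ G] {ν : Measure X} [SFinite ν]
    {μ : Measure G} [SFinite μ] [μ.IsMulRightInvariant]
    (hα : ∀ g, MeasurePreserving (α g) ν ν) (hβ : ∀ g, MeasurePreserving (autAction β g) μ μ)
    (g : Γ) : MeasurePreserving (skewProduct α β σ hσ g) (ν.prod μ) (ν.prod μ) := by
  refine (hα g).skew_product (g := fun x y => β g y * σ g x) ?_ (Eventually.of_forall fun x => ?_)
  · exact ((hβ g).measurable.comp measurable_snd).mul ((hσ.measurable g).comp measurable_fst)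
  · exact ((measurePreserving_mul_right μ (σ g x)).comp (hβ g)).map_eq

variable {ν : Measure X} [IsProbabilityMeasure ν] {μ : Measure G} [IsProbabilityMeasure μ]
  [Finite K] {π}

theorem tendsto_entropyReal_join_skewProduct_sub
    (hβ : ∀ g, MeasurePreserving (autAction β g) μ μ) (hπ : IsMeasurablePartition π)
    {τ : ℕ → Type*} [∀ k, Countable (τ k)] {A : ∀ k, X → τ k} (hA : ∀ k, FiniteEntropy ν (A k))
    {W : Set Γ} (hW : W.Finite)
    (hc : Tendsto (fun k => condEntropyReal ν (A k) (cocyclePartition σ π W)) atTop (𝓝 0)) :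
    Tendsto (fun k => entropyReal (ν.prod μ) (join (A k ∘ Prod.fst)
        (joinOver (skewProduct α β σ hσ) W (π ∘ Prod.snd))) - entropyReal ν (A k)) atTop
      (𝓝 (entropyReal μ (joinOver (autAction β) W π))) := by
  have := hW.to_subtype
  have hT := (hπ.finiteEntropy μ).joinOver hβ hW
  have hcW := finiteEntropy_cocyclePartition hσ hπ hW ν
  have hlim := hc.const_add (entropyReal μ (joinOver (autAction β) W π))
  rw [add_zero] at hlim
  rw [joinOver_skewProduct_snd]
  refine tendsto_of_tendsto_of_tendsto_of_le_of_le tendsto_const_nhds hlim (fun k => ?_)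
    (fun k => ?_)
  · exact le_sub_iff_add_le'.2 (le_entropyReal_join_twist (hA k) hcW hT)
  · rw [sub_le_iff_le_add']
    exact (entropyReal_join_twist_le (hA k) hcW hT).trans_eq (add_assoc _ _ _)

end SkewProduct

section SkewProductEntropy

variable {r : ℕ} {X G K ι : Type*} [Group G] [Group K] [MeasurableSpace X] [MeasurableSpace G]
  {α : FreeGroup (Fin r) →* Equiv.Perm X} {β : FreeGroup (Fin r) →* MulAut G}
  {σ : FreeGroup (Fin r) → X → G} (hσ : IsCocycle α β σ)

theorem bigF_join_joinOver_skewProduct (ρ : Measure (X × G)) (π : G →* K) (A : X → ι)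
    (W : Set (FreeGroup (Fin r))) :
    bigF (skewProduct α β σ hσ) ρ
        (join (A ∘ Prod.fst) (joinOver (skewProduct α β σ hσ) W (π ∘ Prod.snd))) =
      (1 - 2 * (r : ℝ)) * entropyReal ρ
          (join (A ∘ Prod.fst) (joinOver (skewProduct α β σ hσ) W (π ∘ Prod.snd))) +
        ∑ i : Fin r, entropyReal ρ (join (join A (translate α (FreeGroup.of i) A) ∘ Prod.fst)
          (joinOver (skewProduct α β σ hσ) (W ∪ FreeGroup.of i • W) (π ∘ Prod.snd))) := by
  rw [bigF_eq]
  congr 1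
  refine Finset.sum_congr rfl fun i _ => entropyReal_congr ρ ?_
  rw [translate_join, translate_skewProduct_fst]
  simp only [ker_join, join_comp, ker_translate_joinOver]
  rw [inf_inf_inf_comm]
  simp only [ker_joinOver, iInf_union]

variable {ν : Measure X} [IsProbabilityMeasure ν] {μ : Measure G} [IsProbabilityMeasure μ]
  (hα : ∀ g, MeasurePreserving (α g) ν ν) (hβ : ∀ g, MeasurePreserving (autAction β g) μ μ)
  [Finite K] {π : G →* K} (hπ : IsMeasurablePartition π) [Countable ι]

include hα hβ hπ

theorem tendsto_bigF_join_skewProduct_sub {P : X → ι} (hg : IsGenerating α ν P)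
    (hP : FiniteEntropy ν P) {W : Set (FreeGroup (Fin r))} (hW : W.Finite) :
    Tendsto (fun k => bigF (skewProduct α β σ hσ) (ν.prod μ)
        (join (joinOver α (ball r k) P ∘ Prod.fst)
          (joinOver (skewProduct α β σ hσ) W (π ∘ Prod.snd))) -
        bigF α ν (joinOver α (ball r k) P)) atTop
      (𝓝 (bigF (autAction β) μ (joinOver (autAction β) W π))) := by
  have hA (k : ℕ) := hP.joinOver hα (finite_ball r k)
  have hc {V : Set (FreeGroup (Fin r))} (hV : V.Finite) :=
    finiteEntropy_cocyclePartition hσ hπ hV ν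
  have hlim {V : Set (FreeGroup (Fin r))} (hV : V.Finite) :
      Tendsto (fun k => condEntropyReal ν (joinOver α (ball r k) P) (cocyclePartition σ π V))
        atTop (𝓝 0) :=
    hg.tendsto_condEntropyReal_joinOver_ball hα (hc hV)
  have hterm (i : Fin r) :
      Tendsto (fun k => entropyReal (ν.prod μ)
          (join (join (joinOver α (ball r k) P)
            (translate α (FreeGroup.of i) (joinOver α (ball r k) P)) ∘ Prod.fst)
            (joinOver (skewProduct α β σ hσ) (W ∪ FreeGroup.of i • W) (π ∘ Prod.snd))) -
          entropyReal ν (join (joinOver α (ball r k) P)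
            (translate α (FreeGroup.of i) (joinOver α (ball r k) P)))) atTop
        (𝓝 (entropyReal μ (joinOver (autAction β) (W ∪ FreeGroup.of i • W) π))) := by
    have hV : (W ∪ FreeGroup.of i • W).Finite := hW.union hW.smul_set
    have := hV.to_subtype
    exact tendsto_entropyReal_join_skewProduct_sub hσ hβ hπ
      (fun k => (hA k).join ((hA k).translate hα (FreeGroup.of i))) hV
      (squeeze_zero (fun _ => condEntropyReal_nonneg _ _ _)
        (fun k => condEntropyReal_join_translate_le hα (hA k) (hc hV) _) (hlim hV))
  have hmain := ((tendsto_entropyReal_join_skewProduct_sub hσ hβ hπ hA hW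
    (hlim hW)).const_mul (1 - 2 * (r : ℝ))).add (tendsto_finsetSum Finset.univ fun i _ => hterm i)
  rw [bigF_joinOver]
  refine hmain.congr fun k => ?_
  rw [bigF_join_joinOver_skewProduct, bigF_eq, Finset.sum_sub_distrib]
  ring

theorem smallF_skewProduct
    (hγ : ∀ g, MeasurePreserving (skewProduct α β σ hσ g) (ν.prod μ) (ν.prod μ)) {P : X → ι}
    (hg : IsGenerating α ν P) (hP : FiniteEntropy ν P) :
    smallF (skewProduct α β σ hσ) (ν.prod μ) (join (P ∘ Prod.fst) (π ∘ Prod.snd)) =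
      smallF α ν P + smallF (autAction β) μ π := by
  have hP' := hP.comp_measurePreserving (measurePreserving_fst (μ := ν) (ν := μ))
  have hπ' := (hπ.finiteEntropy μ).comp_measurePreserving (measurePreserving_snd (μ := ν) (ν := μ))
  have hinner (n : ℕ) :
      ⨅ k, (bigF (skewProduct α β σ hσ) (ν.prod μ)
        (join (joinOver (skewProduct α β σ hσ) (ball r k) (P ∘ Prod.fst))
          (joinOver (skewProduct α β σ hσ) (ball r n) (π ∘ Prod.snd))) : EReal) =
        smallF α ν P + bigF (autAction β) μ (joinOver (autAction β) (ball r n) π) := by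
    have hlim := tendsto_bigF_join_skewProduct_sub hσ hα hβ hπ hg hP (finite_ball r n)
    simp_rw [← joinOver_skewProduct_fst hσ] at hlim
    rw [smallF_eq_iInf hα hP]
    exact iInf_coe_eq_add_of_tendsto_sub
      (antitone_bigF_join_joinOver hγ hP' (hπ'.joinOver hγ (finite_ball r n)))
      (antitone_bigF_joinOver hα hP) hlim
  simp_rw [smallF_join hγ hP' hπ', hinner, smallF_eq_iInf hβ (hπ.finiteEntropy μ)]
  exact iInf_const_add (smallF_ne_top hα hP) _

end SkewProductEntropy

section SkewProductGenerating

/-- The σ-algebra of the sets that agree up to a `ν`-null set with a set of the smallest invariant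
σ-algebra containing the cells of `P`. -/
abbrev completedInvariantSigma {Γ X ι : Type*} [Group Γ] [MeasurableSpace X] (α : Γ →* Equiv.Perm X)
    (ν : Measure X) (P : X → ι) : MeasurableSpace X :=
  eventuallyMeasurableSpace (invariantSigma α P) (ae ν)

theorem measurableSet_completedInvariantSigma_translate {Γ X ι : Type*} [Group Γ]
    [MeasurableSpace X] (α : Γ →* Equiv.Perm X) (ν : Measure X) (P : X → ι) (g : Γ) (i : ι) :
    MeasurableSet[completedInvariantSigma α ν P] (translate α g P ⁻¹' {i}) :=
  le_eventuallyMeasurableSpace _ (measurableSet_invariantSigma_translate α P g i)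

theorem isGenerating_iff {Γ X ι : Type*} [Group Γ] [m : MeasurableSpace X]
    {α : Γ →* Equiv.Perm X} {ν : Measure X} {P : X → ι} :
    IsGenerating α ν P ↔ IsMeasurablePartition P ∧ m ≤ completedInvariantSigma α ν P := by
  refine ⟨fun h => ⟨h.isMeasurablePartition, fun s hs => ?_⟩, fun h => ⟨h.1, fun s hs => ?_⟩⟩
  · obtain ⟨t, ht, hts⟩ := h.exists_ae_eq s hs
    exact ⟨t, ht, hts.symm⟩
  · obtain ⟨t, ht, hst⟩ := h.2 s hs
    exact ⟨t, ht, hst.symm⟩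

theorem IsGenerating.le_map {Γ Δ X Z ι κ : Type*} [Group Γ] [Group Δ] [m : MeasurableSpace X]
    [MeasurableSpace Z] {α : Γ →* Equiv.Perm X} {γ : Δ →* Equiv.Perm Z} {ν : Measure X}
    {ρ : Measure Z} {P : X → ι} {R : Z → κ} (hP : IsGenerating α ν P) {φ : Z → X}
    (hφ : Measure.QuasiMeasurePreserving φ ρ ν)
    (h : ∀ g i, MeasurableSet[completedInvariantSigma γ ρ R] (φ ⁻¹' (translate α g P ⁻¹' {i}))) :
    m ≤ (completedInvariantSigma γ ρ R).map φ := by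
  intro s hs
  obtain ⟨t, ht, hts⟩ := hP.exists_ae_eq s hs
  have hle : invariantSigma α P ≤ (completedInvariantSigma γ ρ R).map φ := invariantSigma_le h
  obtain ⟨u, hu, hut⟩ := hle t ht
  exact ⟨u, hu, (hφ.preimage_ae_eq hts).symm.trans hut⟩

variable {Γ X G K ι : Type*} [Group Γ] [Group G] [Group K] [MeasurableSpace X]
  [MeasurableSpace G] {α : Γ →* Equiv.Perm X} {β : Γ →* MulAut G} {σ : Γ → X → G}
  (hσ : IsCocycle α β σ) {ν : Measure X} {μ : Measure G} [Countable ι] [Countable K]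
  {P : X → ι} {π : G →* K}

theorem measurable_fst_completedInvariantSigma_skewProduct (hP : IsGenerating α ν P) :
    Measurable[completedInvariantSigma (skewProduct α β σ hσ) (ν.prod μ)
      (join (P ∘ Prod.fst) (π ∘ Prod.snd))] (Prod.fst : X × G → X) := by
  refine hP.le_map Measure.quasiMeasurePreserving_fst fun g => ?_
  have hcell := measurableSet_completedInvariantSigma_translate (skewProduct α β σ hσ)
    (ν.prod μ) (join (P ∘ Prod.fst) (π ∘ Prod.snd)) g
  refine @IsMeasurablePartition.of_ker_le _ _ _ (_) _ (translate α g P ∘ Prod.fst) _ hcell ?_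
  rw [← translate_skewProduct_fst hσ, translate_join, ker_join]
  exact inf_le_left

theorem measurable_snd_completedInvariantSigma_skewProduct (hP : IsGenerating α ν P)
    (hπ : IsGenerating (autAction β) μ π) :
    Measurable[completedInvariantSigma (skewProduct α β σ hσ) (ν.prod μ)
      (join (P ∘ Prod.fst) (π ∘ Prod.snd))] (Prod.snd : X × G → G) := by
  refine hπ.le_map Measure.quasiMeasurePreserving_snd fun g => ?_
  have hcell := measurableSet_completedInvariantSigma_translate (skewProduct α β σ hσ)
    (ν.prod μ) (join (P ∘ Prod.fst) (π ∘ Prod.snd)) g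
  have hshift : @IsMeasurablePartition _ _ (completedInvariantSigma _ _ _)
      ((π ∘ σ g⁻¹) ∘ Prod.fst) := fun c =>
    measurable_fst_completedInvariantSigma_skewProduct (μ := μ) (π := π) hσ hP
      (hσ.measurable g⁻¹ (hπ.measurableSet_cell c))
  refine @IsMeasurablePartition.of_ker_le _ _ _ (_) _ (translate (autAction β) g π ∘ Prod.snd) _
    (@IsMeasurablePartition.join _ _ _ (_) _ _ hcell hshift) ?_
  rw [translate_join, translate_skewProduct_snd, ker_join, ker_join]
  rintro p p' ⟨⟨-, hcell_eq⟩, hshift_eq⟩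
  exact mul_right_cancel (hcell_eq.trans (congrArg _ hshift_eq.symm))

theorem isGenerating_skewProduct (hP : IsGenerating α ν P)
    (hπ : IsGenerating (autAction β) μ π) :
    IsGenerating (skewProduct α β σ hσ) (ν.prod μ) (join (P ∘ Prod.fst) (π ∘ Prod.snd)) :=
  isGenerating_iff.2 ⟨(hP.isMeasurablePartition.comp measurable_fst).join
      (hπ.isMeasurablePartition.comp measurable_snd),
    sup_le (measurable_fst_completedInvariantSigma_skewProduct hσ hP).comap_le
      (measurable_snd_completedInvariantSigma_skewProduct hσ hP hπ).comap_le⟩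

end SkewProductGenerating

section Haar

variable {G : Type*} [Group G] [TopologicalSpace G] [IsTopologicalGroup G] [CompactSpace G]
  [MeasurableSpace G] [BorelSpace G] (μ : Measure G) [μ.IsHaarMeasure] [IsProbabilityMeasure μ]

theorem measurePreserving_autAction {Γ : Type*} [Group Γ] {β : Γ →* MulAut G}
    (hβ : ∀ g, Continuous (β g)) (g : Γ) : MeasurePreserving (autAction β g) μ μ := by
  have hsymm : Continuous (β g).symm := by
    have := hβ g⁻¹
    rwa [map_inv] at this
  have : (μ.map (β g)).IsHaarMeasure := MulEquiv.isHaarMeasure_map μ (β g) (hβ g) hsymm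
  have := Measure.isProbabilityMeasure_map (μ := μ) (hβ g).aemeasurable
  exact ⟨(hβ g).measurable, Measure.isHaarMeasure_eq_of_isProbabilityMeasure (μ.map (β g)) μ⟩

theorem isMulRightInvariant_of_isHaarMeasure : μ.IsMulRightInvariant where
  map_mul_right_eq_self c := by
    have := Measure.isProbabilityMeasure_map (μ := μ) (measurable_mul_const c).aemeasurable
    exact Measure.isHaarMeasure_eq_of_isProbabilityMeasure _ _

end Haar

end FInvariant

end

theorem theorem3p2_general {r : ℕ} {X : Type*} [MeasurableSpace X]
    (ν : Measure X) [IsProbabilityMeasure ν]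
    (α : FreeGroup (Fin r) →* Equiv.Perm X) (hα : ∀ g, MeasurePreserving (α g) ν ν)
    {G : Type*} [Group G] [MeasurableSpace G] [MeasurableMul₂ G]
    (μ : Measure G) [μ.IsMulRightInvariant] [IsProbabilityMeasure μ]
    (β : FreeGroup (Fin r) →* MulAut G)
    (hβ : ∀ g, MeasurePreserving (FInvariant.autAction β g) μ μ)
    (σ : FreeGroup (Fin r) → X → G) (hσ : FInvariant.IsCocycle α β σ)
    (hN : ∃ N : Subgroup G, N.Normal ∧ N.FiniteIndex ∧
      FInvariant.IsGenerating (FInvariant.autAction β) μ (fun g : G => (g : G ⧸ N)))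
    (hP : ∃ P : X → ℕ, FInvariant.IsFiniteEntropyGenerator α ν P) :
    ∃ a b : EReal,
      FInvariant.HasFInvariant α ν a ∧
      FInvariant.HasFInvariant (FInvariant.autAction β) μ b ∧
      FInvariant.HasFInvariant (FInvariant.skewProduct α β σ hσ) (ν.prod μ) (a + b) := by
  obtain ⟨N, hN_normal, hN_index, hπ⟩ := hN
  obtain ⟨P, hP, hP_ne_top⟩ := hP
  replace hπ : FInvariant.IsGenerating (FInvariant.autAction β) μ (QuotientGroup.mk' N) := hπ
  have hγ := FInvariant.measurePreserving_skewProduct hσ hα hβ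
  have hPfin : FInvariant.FiniteEntropy ν P := ⟨hP.isMeasurablePartition, hP_ne_top⟩
  have hπfin := hπ.isMeasurablePartition.finiteEntropy μ
  refine ⟨_, _, hP.hasFInvariant hα hPfin.ne_top, hπ.hasFInvariant hβ hπfin.ne_top, ?_⟩
  rw [← FInvariant.smallF_skewProduct hσ hα hβ hπ.isMeasurablePartition hγ hP hPfin]
  exact (FInvariant.isGenerating_skewProduct hσ hP hπ).hasFInvariant hγ
    ((hPfin.comp_measurePreserving measurePreserving_fst).join
      (hπfin.comp_measurePreserving measurePreserving_snd)).ne_top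

theorem theorem3p2 {r : ℕ}
    {X : Type*} [MeasurableSpace X] [StandardBorelSpace X]
    (ν : Measure X) [IsProbabilityMeasure ν]
    (α : FreeGroup (Fin r) →* Equiv.Perm X) (hα : ∀ g, MeasurePreserving (α g) ν ν)
    {G : Type*} [Group G] [TopologicalSpace G] [IsTopologicalGroup G] [CompactSpace G]
    [TopologicalSpace.MetrizableSpace G] [TotallyDisconnectedSpace G]
    [MeasurableSpace G] [BorelSpace G]
    (μ : Measure G) [μ.IsHaarMeasure] [IsProbabilityMeasure μ]
    (β : FreeGroup (Fin r) →* MulAut G) (hβ : ∀ g, Continuous (β g))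
    (σ : FreeGroup (Fin r) → X → G) (hσ : FInvariant.IsCocycle α β σ)
    (hN : ∃ N : Subgroup G, N.Normal ∧ N.FiniteIndex ∧ IsClopen (N : Set G) ∧
      FInvariant.IsGenerating (FInvariant.autAction β) μ (fun g : G => (g : G ⧸ N)))
    (hP : ∃ P : X → ℕ, FInvariant.IsFiniteEntropyGenerator α ν P) :
    ∃ a b : EReal,
      FInvariant.HasFInvariant α ν a ∧
      FInvariant.HasFInvariant (FInvariant.autAction β) μ b ∧
      FInvariant.HasFInvariant (FInvariant.skewProduct α β σ hσ) (ν.prod μ) (a + b) := by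
  obtain ⟨N, hN_normal, hN_index, -, hN_generating⟩ := hN
  have := FInvariant.isMulRightInvariant_of_isHaarMeasure μ
  exact theorem3p2_general ν α hα μ β (FInvariant.measurePreserving_autAction μ hβ) σ hσ
    ⟨N, hN_normal, hN_index, hN_generating⟩ hP
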